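/- **Setting.** Manifolds and Lie groups are smooth, without boundary, modelled on real normed spaces (in particular, all finite-dimensional and Banach ones are allowed). Let $(H\xrightarrow{\alpha}D)$ be a crossed module of Lie groups: $\alpha$ is a smooth homomorphism and $D$ acts smoothly on $H$ by automorphisms $(d,h)\mapsto{}^dh$, with ${}^{\alpha(h)}h'=hh'h^{-1}$ and $\alpha({}^dh)=d\,\alpha(h)\,d^{-1}$. Let $\{O_\alpha\}$ be an open cover of a manifold $X$ and $(d_{\alpha\beta},h_{\alpha\beta\gamma})$ a cocycle of a crossed module bundle gerbe: smooth maps $d_{\alpha\beta}:O_\alpha\cap O_\beta\to D$, $h_{\alpha\beta\gamma}:O_\alpha\cap O_\beta\cap O_\gamma\to H$ with $$d_{\alpha\beta}d_{\beta\gamma}=\alpha(h_{\alpha\beta\gamma})d_{\alpha\gamma},\qquad h_{\alpha\beta\gamma}h_{\alpha\gamma\delta}={}^{d_{\alpha\beta}}h_{\beta\gamma\delta}\,h_{\alpha\beta\delta},$$ normalized by $h_{\alpha\alpha\alpha}=1$ (hence $d_{\alpha\alpha}=1$ and $h_{\alpha\alpha\beta}=h_{\alpha\beta\beta}=1$). **Gerbe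 connections.** For a smooth map $f$ into a Lie group, $f\,df^{-1}$ denotes the Lie algebra valued one-form whose value at $x$ is the derivative at $y=x$ of $y\mapsto f(x)f(y)^{-1}$. A gerbe connection is a collection of smooth one-forms $A_\alpha\in\Omega^1(O_\alpha)\otimes\mathrm{Lie}(D)$, $a_{\alpha\beta}\in\Omega^1(O_\alpha\cap O_\beta)\otimes\mathrm{Lie}(H)$ with $$A_\alpha+\alpha(a_{\alpha\beta})=d_{\alpha\beta}A_\beta d_{\alpha\beta}^{-1}+d_{\alpha\beta}\,dd_{\alpha\beta}^{-1}\quad\text{on }O_\alpha\cap O_\beta,$$ $$a_{\alpha\beta}+{}^{d_{\alpha\beta}}a_{\beta\gamma}=h_{\alpha\beta\gamma}a_{\alpha\gamma}h_{\alpha\beta\gamma}^{-1}+h_{\alpha\beta\gamma}\,dh_{\alpha\beta\gamma}^{-1}+T_{A_\alpha}(h_{\alpha\beta\gamma})\quad\text{on }O_\alpha\cap O_\beta\cap O_\gamma,$$ where, for $Y\in\mathrm{Lie}(D)$ and $h\in H$, $T_Y(h)\in\mathrm{Lie}(H)$ is the velocity at $t=0$ of the curve $t\mapsto h\cdot{}^{c(t)}(h^{-1})$,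 $c$ being a curve in $D$ through $1$ with velocity $Y$, such as $\exp(tY)$. **The simplicial bundle.** Let $G_n=N_n\mathcal C_{(H\to D)}$ be the Lie group of $n$-simplices of the nerve of the category with objects $d\in D$ and morphisms $h:d\to\alpha(h)d$. Such a simplex is a chain $d_n\to\cdots\to d_1\to d_0$, with vertices $d_i\in D$ and edges $h_{ij}:d_j\to d_i$ satisfying $h_{ij}h_{jk}=h_{ik}$. Vertices are multiplied in $D$ and edges by $(h_{ij})(h'_{ij})=h_{ij}\,{}^{d_j}h'_{ij}$. The face $\partial_i$ omits and the degeneracy $s_i$ repeats the vertex $i$. Let $X_n=\bigsqcup_{\alpha_0,\dots,\alpha_n}O_{\alpha_0}\cap\cdots\cap O_{\alpha_n}$ be the nerve of the Čech groupoid of the cover, where $\partial_i$ omits and $s_i$ repeats the index $\alpha_i$. The cocycle defines the twisting function $\tau:X_{n+1}\to G_n$ for which $\tau(x)$, with $x$ in the component $(\alpha_0,\dots,\alpha_{n+1})$, has the vertices $d_{\alpha_0\alpha_{i+1}}d_{\alpha_1\alpha_{i+1}}^{-1}$ and the edges $h_{\alpha_0\alpha_1\alpha_{i+1}}^{-1}h_{\alpha_0\alpha_1\alpha_{j+1}}$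 ($0\le i,j\le n$). So $\tau$ is $d_{\alpha\beta}$ on $X_1$, and $d_{\alpha\gamma}d_{\beta\gamma}^{-1}\xrightarrow{h_{\alpha\beta\gamma}}d_{\alpha\beta}$ on $X_2$. The corresponding principal $N\mathcal C_{(H\to D)}$-bundle is $P_n=G_n\times X_n$ with $\partial_0(g,x)=(\partial_0g\cdot\tau(x),\partial_0x)$, $\partial_i(g,x)=(\partial_ig,\partial_ix)$ for $i>0$, $s_i(g,x)=(s_ig,s_ix)$, and left multiplication as the action of $G_n$. **Simplicial connections.** A simplicial connection on $P$ is a collection of smooth one-forms $\mathcal A_n\in\Omega^1(P_n)\otimes\mathrm{Lie}(G_n)$, $n\ge0$, such that (i) $\partial_i^*\mathcal A=\partial_i\mathcal A$ and $s_i^*\mathcal A=s_i\mathcal A$, where the maps on the right act on the Lie algebras; (ii) $g^*\mathcal A_n=g\mathcal A_ng^{-1}$ for $g\in G_n$; (iii) the restriction of $\mathcal A_n$ to each fibre $G_n\times\{x\}$ is $g\,dg^{-1}$. **Proposition.** Let $\sigma(x)=(1,x)$. Say that a simplicial connection $\mathcal A$ and a gerbe connection $(A_\alpha,a_{\alpha\beta})$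 correspond to each other if $A_\alpha$ is the component over $O_\alpha$ of $\sigma^*\mathcal A_0$ and $-a_{\alpha\beta}$ is the component over $O_\alpha\cap O_\beta$ of the $\mathrm{Lie}(H)$-valued morphism part $a_{01}$ of $\sigma^*\mathcal A_1=(\partial_0A_1\xrightarrow{a_{01}}\partial_1A_1)$. Then each gerbe connection corresponds to exactly one simplicial connection on $P$, and each simplicial connection on $P$ corresponds to exactly one gerbe connection. -/

import Mathlib

open scoped Manifold ContDiff Topology
open TopologicalSpace (Opens IsOpenCover)

set_option linter.unusedSectionVars false

noncomputable section

namespace CrossedGerbe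

/-! ### Finite powers of a manifold

Only the facts that make `Fin n → K` a smooth manifold, modelled on `Fin n → F`. -/

section Pi

variable {F : Type*} [NormedAddCommGroup F] [NormedSpace ℝ F]
  {K : Type*} [TopologicalSpace K] [ChartedSpace F K]

/-- The charts of a finite power are the products of charts. -/
@[reducible] def powChartedSpace (n : ℕ) : ChartedSpace (Fin n → F) (Fin n → K) :=
  inferInstanceAs (ChartedSpace (ModelPi fun _ : Fin n => F) (Fin n → K))

attribute [local instance] powChartedSpace

theorem powIsManifold [IsManifold 𝓘(ℝ, F) ∞ K] (n : ℕ) :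
    IsManifold 𝓘(ℝ, Fin n → F) ∞ (Fin n → K) := by
  apply isManifold_of_contDiffOn
  rintro _ _ ⟨e, he, rfl⟩ ⟨e', he', rfl⟩
  rw [contDiffOn_pi]
  intro i
  have hc := ((contDiffGroupoid ∞ 𝓘(ℝ, F)).compatible (he i trivial) (he' i trivial)).1
  have h : ContDiffOn ℝ ∞ ((e i).symm ≫ₕ e' i) ((e i).symm ≫ₕ e' i).source := by
    simpa [contDiffPregroupoid] using hc
  refine h.comp (f := fun x : Fin n → F => x i)
    (contDiff_apply ℝ F i).contDiffOn ?_
  rintro x ⟨⟨hx1, hx2⟩, -⟩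
  exact ⟨hx1 i trivial, hx2 i trivial⟩

variable {E : Type*} [NormedAddCommGroup E] [NormedSpace ℝ E]
  {B : Type*} [TopologicalSpace B] {I : ModelWithCorners ℝ E B}
  {M : Type*} [TopologicalSpace M] [ChartedSpace B M]

theorem contMDiff_pow_iff {n : ℕ} {f : M → Fin n → K} :
    ContMDiff I 𝓘(ℝ, Fin n → F) ∞ f ↔ ∀ i, ContMDiff I 𝓘(ℝ, F) ∞ (fun x => f x i) := by
  have key : ∀ x : M, ContMDiffAt I 𝓘(ℝ, Fin n → F) ∞ f x ↔
      ∀ i, ContMDiffAt I 𝓘(ℝ, F) ∞ (fun x => f x i) x := by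
    intro x
    simp only [contMDiffAt_iff, continuousAt_pi, forall_and]
    refine and_congr Iff.rfl ?_
    rw [contDiffWithinAt_pi]
    rfl
  exact ⟨fun h i x => (key x).1 (h x) i, fun h x => (key x).2 fun i => h i x⟩

end Pi

/-! ### One-forms and the differential calculus on Lie groups -/

section Forms

variable {E : Type*} [NormedAddCommGroup E] [NormedSpace ℝ E]
  {B : Type*} [TopologicalSpace B] (I : ModelWithCorners ℝ E B)
  (M : Type*) [TopologicalSpace M] [ChartedSpace B M] [IsManifold I ∞ M]
  {E₁ : Type*} [NormedAddCommGroup E₁] [NormedSpace ℝ E₁]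
  {B₁ : Type*} [TopologicalSpace B₁] (I₁ : ModelWithCorners ℝ E₁ B₁)
  {E₂ : Type*} [NormedAddCommGroup E₂] [NormedSpace ℝ E₂]
  {B₂ : Type*} [TopologicalSpace B₂] (I₂ : ModelWithCorners ℝ E₂ B₂)

/-- The space `Ω¹(M) ⊗ Lie(G)` of smooth one-forms on `M` with values in the Lie algebra
`Lie(G) = T₁ G`: a continuous linear map `T_x M → Lie(G)` for each point `x`, which is smooth
as a function on the total space of the tangent bundle (`Lie(G)` is, as a vector space, the model
space `E₁` of `G`). -/
@[ext] structure OneForm (G : Type*) [TopologicalSpace G] [ChartedSpace B₁ G] [Group G] where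
  toFun : ∀ x : M, TangentSpace I x →L[ℝ] GroupLieAlgebra I₁ G
  smooth : ContMDiff (M := TangentBundle I M) (M' := E₁) I.tangent 𝓘(ℝ, E₁) ∞
    (fun v => toFun v.1 v.2)

variable {I M I₁}
variable {G : Type*} [TopologicalSpace G] [ChartedSpace B₁ G] [Group G]
  {N : Type*} [TopologicalSpace N] [ChartedSpace B₂ N]

variable {I₂} in
/-- The pullback `f^* η` of a one-form, at the point `x`. -/
def OneForm.pull (η : OneForm I M I₁ G) (f : N → M) (x : N) :
    TangentSpace I₂ x →L[ℝ] GroupLieAlgebra I₁ G :=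
  (η.toFun (f x)).comp (mfderiv I₂ I f x)

variable (I₁) in
/-- The linear map `Lie(G) → Lie(G')` induced by a map `f : G → G'` with `f 1 = 1`. -/
def lieMap {G' : Type*} [TopologicalSpace G'] [ChartedSpace B₂ G'] [Group G'] (f : G → G') :
    GroupLieAlgebra I₁ G →L[ℝ] GroupLieAlgebra I₂ G' :=
  mfderiv I₁ I₂ f 1

variable (I₁) in
/-- The adjoint action of a Lie group on its Lie algebra, `X ↦ g X g⁻¹`. -/
def Ad (g : G) : GroupLieAlgebra I₁ G →L[ℝ] GroupLieAlgebra I₁ G :=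
  mfderiv I₁ I₁ (fun k : G => g * k * g⁻¹) 1

variable (I₁) in
/-- The `Lie(G)`-valued one-form `f d(f⁻¹)` of a map `f : N → G`, at the point `x`: the derivative
at `y = x` of `y ↦ f(x) f(y)⁻¹`, which takes the value `1` at `y = x`. -/
def mulDInv (f : N → G) (x : N) : TangentSpace I₂ x →L[ℝ] GroupLieAlgebra I₁ G :=
  mfderiv I₂ I₁ (fun y : N => f x * (f y)⁻¹) x

end Forms

/-! ### Crossed modules of Lie groups -/

section Crossed

variable (ED EH D H : Type*)
  [NormedAddCommGroup ED] [NormedSpace ℝ ED] [NormedAddCommGroup EH] [NormedSpace ℝ EH]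
  [TopologicalSpace D] [ChartedSpace ED D] [Group D] [LieGroup 𝓘(ℝ, ED) ∞ D]
  [TopologicalSpace H] [ChartedSpace EH H] [Group H] [LieGroup 𝓘(ℝ, EH) ∞ H]

/-- A crossed module `(H → D)` of Lie groups: `bdry` is the homomorphism `α : H → D`, and
`act d h` is `ᵈh`. -/
structure CrossedModule where
  bdry : H →* D
  act : D →* MulAut H
  smooth_bdry : ContMDiff 𝓘(ℝ, EH) 𝓘(ℝ, ED) ∞ bdry
  smooth_act : ContMDiff (𝓘(ℝ, ED).prod 𝓘(ℝ, EH)) 𝓘(ℝ, EH) ∞ (fun p : D × H => act p.1 p.2)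
  peiffer : ∀ h h' : H, act (bdry h) h' = h * h' * h⁻¹
  equivariant : ∀ (d : D) (h : H), bdry (act d h) = d * bdry h * d⁻¹

variable {ED EH D H}
variable (𝔛 : CrossedModule ED EH D H)

namespace CrossedModule

/-- The action of `d ∈ D` on `Lie(H)`, written `ᵈX`. -/
def actLie (d : D) : GroupLieAlgebra 𝓘(ℝ, EH) H →L[ℝ] GroupLieAlgebra 𝓘(ℝ, EH) H :=
  lieMap 𝓘(ℝ, EH) 𝓘(ℝ, EH) (fun h => 𝔛.act d h)

/-- The map `X ↦ T_X(h)` from `Lie(D)` to `Lie(H)`: `T_X(h)` is the velocity at `t = 0` of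
`t ↦ h · ᶜ⁽ᵗ⁾(h⁻¹)`, for a curve `c` in `D` through `1` with velocity `X`, such as
`c(t) = exp(tX)`. -/
def T (h : H) : GroupLieAlgebra 𝓘(ℝ, ED) D →L[ℝ] GroupLieAlgebra 𝓘(ℝ, EH) H :=
  lieMap 𝓘(ℝ, ED) 𝓘(ℝ, EH) (fun d : D => h * 𝔛.act d h⁻¹)

/-- The group of `n`-simplices of the nerve of the category with objects `d ∈ D` and morphisms
`h : d → α(h) d`. An `n`-simplex `dₙ → ⋯ → d₁ → d₀` is recorded by its source `dₙ` and by the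
morphisms `hₖₙ : dₙ → dₖ`, `k < n`; all vertices and edges are recovered by `Nerve.obj` and
`Nerve.hom` below, and for `n = 1` this is the pair `(h₀₁, d₁) ∈ H ⋊ D`. -/
def Nerve (_𝔛 : CrossedModule ED EH D H) (n : ℕ) : Type _ := D × (Fin n → H)

namespace Nerve

attribute [local instance] powChartedSpace

variable {𝔛} {n m : ℕ}

instance : TopologicalSpace (𝔛.Nerve n) := inferInstanceAs (TopologicalSpace (D × (Fin n → H)))

instance : ChartedSpace (ModelProd ED (Fin n → EH)) (𝔛.Nerve n) :=
  inferInstanceAs (ChartedSpace (ModelProd ED (Fin n → EH)) (D × (Fin n → H)))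

/-- The morphism from the last vertex to the `k`-th one (the identity if `k` is last). -/
def fromLast (g : 𝔛.Nerve n) : Fin (n + 1) → H := Fin.snoc (α := fun _ => H) g.2 1

/-- The `k`-th vertex `dₖ` of a simplex. -/
def obj (g : 𝔛.Nerve n) (k : Fin (n + 1)) : D := 𝔛.bdry (g.fromLast k) * g.1

/-- The edge `hᵢⱼ : dⱼ → dᵢ` of a simplex. -/
def hom (g : 𝔛.Nerve n) (i j : Fin (n + 1)) : H := g.fromLast i * (g.fromLast j)⁻¹

/-- Multiplication of simplices: `(h, d) (h', d') = (h ᵈh', d d')`, as in `H ⋊ D`. -/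
instance : Group (𝔛.Nerve n) where
  mul g g' := (g.1 * g'.1, fun k => g.2 k * 𝔛.act g.1 (g'.2 k))
  one := (1, fun _ => 1)
  inv g := (g.1⁻¹, fun k => 𝔛.act g.1⁻¹ (g.2 k)⁻¹)
  mul_assoc a b c := Prod.ext (mul_assoc a.1 b.1 c.1) <| funext fun k => by
    change a.2 k * 𝔛.act a.1 (b.2 k) * 𝔛.act (a.1 * b.1) (c.2 k) =
      a.2 k * 𝔛.act a.1 (b.2 k * 𝔛.act b.1 (c.2 k))
    simp [mul_assoc]
  one_mul a := Prod.ext (one_mul a.1) <| funext fun k => by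
    change 1 * 𝔛.act 1 (a.2 k) = a.2 k
    simp
  mul_one a := Prod.ext (mul_one a.1) <| funext fun k => by
    change a.2 k * 𝔛.act a.1 1 = a.2 k
    simp
  inv_mul_cancel a := Prod.ext (inv_mul_cancel a.1) <| funext fun k => by
    change 𝔛.act a.1⁻¹ (a.2 k)⁻¹ * 𝔛.act a.1⁻¹ (a.2 k) = 1
    simp

@[simp] theorem mul_fst (g g' : 𝔛.Nerve n) : (g * g').1 = g.1 * g'.1 := rfl
@[simp] theorem mul_snd (g g' : 𝔛.Nerve n) (k : Fin n) :
    (g * g').2 k = g.2 k * 𝔛.act g.1 (g'.2 k) := rfl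
@[simp] theorem one_fst : (1 : 𝔛.Nerve n).1 = 1 := rfl
@[simp] theorem one_snd (k : Fin n) : (1 : 𝔛.Nerve n).2 k = 1 := rfl

theorem fst_eq_obj_last (g : 𝔛.Nerve n) : g.1 = g.obj (Fin.last n) := by
  simp [obj, fromLast]

theorem snd_eq_hom_last (g : 𝔛.Nerve n) (k : Fin n) : g.2 k = g.hom k.castSucc (Fin.last n) := by
  simp [hom, fromLast]

/-- An edge `hᵢⱼ` is a morphism from `dⱼ` to `dᵢ`. -/
theorem bdry_hom_mul_obj (g : 𝔛.Nerve n) (i j : Fin (n + 1)) :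
    𝔛.bdry (g.hom i j) * g.obj j = g.obj i := by
  simp [hom, obj, mul_assoc]

/-- Composition of edges. -/
theorem hom_mul_hom (g : 𝔛.Nerve n) (i j k : Fin (n + 1)) :
    g.hom i j * g.hom j k = g.hom i k := by
  simp [hom, mul_assoc]

/-- A simplex is determined by its vertices and edges. -/
theorem ext_obj_hom {g g' : 𝔛.Nerve n} (ho : ∀ i, g.obj i = g'.obj i)
    (hh : ∀ i j, g.hom i j = g'.hom i j) : g = g' :=
  Prod.ext (by rw [fst_eq_obj_last, fst_eq_obj_last, ho])
    (funext fun k => by rw [snd_eq_hom_last, snd_eq_hom_last, hh])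

/-- The simplex with given vertices and edges. -/
def mk (o : Fin (n + 1) → D) (e : Fin (n + 1) → Fin (n + 1) → H) : 𝔛.Nerve n :=
  (o (Fin.last n), fun k => e k.castSucc (Fin.last n))

theorem hom_self_of_mul {e : Fin (n + 1) → Fin (n + 1) → H}
    (hc : ∀ i j k, e i j * e j k = e i k) (i : Fin (n + 1)) : e i i = 1 := by
  simpa using hc i i i

theorem fromLast_mk (o : Fin (n + 1) → D) {e : Fin (n + 1) → Fin (n + 1) → H}
    (hc : ∀ i j k, e i j * e j k = e i k) (i : Fin (n + 1)) :
    fromLast (mk o e : 𝔛.Nerve n) i = e i (Fin.last n) := by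
  refine Fin.lastCases ?_ (fun k => ?_) i
  · simp [fromLast, hom_self_of_mul hc]
  · simp [fromLast, mk]

/-- Every compatible family of vertices and edges comes from a simplex. -/
theorem obj_mk {o : Fin (n + 1) → D} {e : Fin (n + 1) → Fin (n + 1) → H}
    (ho : ∀ i j, 𝔛.bdry (e i j) * o j = o i) (hc : ∀ i j k, e i j * e j k = e i k)
    (i : Fin (n + 1)) : (mk o e : 𝔛.Nerve n).obj i = o i := by
  rw [obj, fromLast_mk o hc]
  exact ho i _

theorem hom_mk (o : Fin (n + 1) → D) {e : Fin (n + 1) → Fin (n + 1) → H}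
    (hc : ∀ i j k, e i j * e j k = e i k)
    (i j : Fin (n + 1)) : (mk o e : 𝔛.Nerve n).hom i j = e i j := by
  rw [hom, fromLast_mk o hc, fromLast_mk o hc, mul_inv_eq_iff_eq_mul, hc]

theorem fromLast_mul (g g' : 𝔛.Nerve n) (i : Fin (n + 1)) :
    (g * g').fromLast i = g.fromLast i * 𝔛.act g.1 (g'.fromLast i) := by
  refine Fin.lastCases ?_ (fun k => ?_) i <;> simp [fromLast]

/-- Vertices are multiplied in `D`. -/
theorem obj_mul (g g' : 𝔛.Nerve n) (i : Fin (n + 1)) : (g * g').obj i = g.obj i * g'.obj i := by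
  simp [obj, fromLast_mul, 𝔛.equivariant, mul_assoc]

/-- Edges are multiplied in the semidirect product `H ⋊ D`. -/
theorem hom_mul (g g' : 𝔛.Nerve n) (i j : Fin (n + 1)) :
    (g * g').hom i j = g.hom i j * 𝔛.act (g.obj j) (g'.hom i j) := by
  simp [hom, obj, fromLast_mul, 𝔛.peiffer, mul_assoc]

/-- The reindexing `g ↦ g ∘ θ` of simplices, the vertex `k` of the new simplex being the vertex
`θ k` of the old one. -/
def map (θ : Fin (m + 1) → Fin (n + 1)) (g : 𝔛.Nerve n) : 𝔛.Nerve m :=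
  mk (fun k => g.obj (θ k)) (fun i j => g.hom (θ i) (θ j))

theorem obj_map (θ : Fin (m + 1) → Fin (n + 1)) (g : 𝔛.Nerve n) (i : Fin (m + 1)) :
    (map θ g).obj i = g.obj (θ i) :=
  obj_mk (fun i j => g.bdry_hom_mul_obj (θ i) (θ j))
    (fun i j k => g.hom_mul_hom (θ i) (θ j) (θ k)) i

theorem hom_map (θ : Fin (m + 1) → Fin (n + 1)) (g : 𝔛.Nerve n) (i j : Fin (m + 1)) :
    (map θ g).hom i j = g.hom (θ i) (θ j) :=
  hom_mk (fun k => g.obj (θ k)) (fun i j k => g.hom_mul_hom (θ i) (θ j) (θ k)) i j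

/-- Reindexing is a group homomorphism, so that the simplices form a simplicial group. -/
theorem map_mul (θ : Fin (m + 1) → Fin (n + 1)) (g g' : 𝔛.Nerve n) :
    map θ (g * g') = map θ g * map θ g' :=
  ext_obj_hom (fun i => by simp only [obj_map, obj_mul])
    (fun i j => by simp only [hom_map, hom_mul, obj_map])

/-- The face map `∂ᵢ`, which omits the vertex `i`. -/
def face (i : Fin (n + 2)) : 𝔛.Nerve (n + 1) → 𝔛.Nerve n := map i.succAbove

/-- The degeneracy map `sᵢ`, which repeats the vertex `i`. -/
def degen (i : Fin (n + 1)) : 𝔛.Nerve n → 𝔛.Nerve (n + 1) := map i.predAbove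

instance : IsManifold (𝓘(ℝ, ED).prod 𝓘(ℝ, Fin n → EH)) ∞ (𝔛.Nerve n) :=
  have := powIsManifold (F := EH) (K := H) n
  IsManifold.prod (n := ∞) D (Fin n → H)

/-- A map into the simplices is smooth if and only if its components are. -/
theorem contMDiff_iff {E : Type*} [NormedAddCommGroup E] [NormedSpace ℝ E]
    {B : Type*} [TopologicalSpace B] {I : ModelWithCorners ℝ E B}
    {M : Type*} [TopologicalSpace M] [ChartedSpace B M] {f : M → 𝔛.Nerve n} :
    ContMDiff I (𝓘(ℝ, ED).prod 𝓘(ℝ, Fin n → EH)) ∞ f ↔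
      ContMDiff I 𝓘(ℝ, ED) ∞ (fun x => (f x).1) ∧
        ∀ k, ContMDiff I 𝓘(ℝ, EH) ∞ (fun x => (f x).2 k) := by
  rw [← contMDiff_pow_iff (f := fun x => (f x).2)]
  exact contMDiff_prod_iff (M' := D) (N' := Fin n → H) f

/-- The simplices form a Lie group. -/
instance : LieGroup (𝓘(ℝ, ED).prod 𝓘(ℝ, Fin n → EH)) ∞ (𝔛.Nerve n) := by
  have hid := contMDiff_iff.1 (contMDiff_id (I := 𝓘(ℝ, ED).prod 𝓘(ℝ, Fin n → EH))
    (M := 𝔛.Nerve n) (n := ∞))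
  refine { contMDiff_mul := contMDiff_iff.2 ⟨?_, fun k => ?_⟩
           contMDiff_inv := contMDiff_iff.2 ⟨?_, fun k => ?_⟩ }
  · exact (hid.1.comp contMDiff_fst).mul (hid.1.comp contMDiff_snd)
  · exact ((hid.2 k).comp contMDiff_fst).mul (𝔛.smooth_act.comp
      ((hid.1.comp contMDiff_fst).prodMk ((hid.2 k).comp contMDiff_snd)))
  · exact hid.1.inv
  · exact 𝔛.smooth_act.comp (hid.1.inv.prodMk (hid.2 k).inv)

end Nerve

end CrossedModule

end Crossed

/-! ### Cocycles, gerbe connections and simplicial connections -/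

section Gerbe

variable {ED EH D H : Type*}
  [NormedAddCommGroup ED] [NormedSpace ℝ ED] [NormedAddCommGroup EH] [NormedSpace ℝ EH]
  [TopologicalSpace D] [ChartedSpace ED D] [Group D] [LieGroup 𝓘(ℝ, ED) ∞ D]
  [TopologicalSpace H] [ChartedSpace EH H] [Group H] [LieGroup 𝓘(ℝ, EH) ∞ H]
  {E X : Type*} [NormedAddCommGroup E] [NormedSpace ℝ E]
  [TopologicalSpace X] [ChartedSpace E X] [IsManifold 𝓘(ℝ, E) ∞ X]
  {ι : Type*}

/-- The component `O_{α₀} ∩ ⋯ ∩ O_{αₙ}`, indexed by `a = (α₀, …, αₙ)`, of the manifold of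
`n`-simplices of the nerve of the Čech groupoid. The manifold of `n`-simplices is the disjoint
union of these components over all `a`. The `i`-th face and degeneracy maps send the component `a`
to the components `a ∘ i.succAbove` and `a ∘ i.predAbove`, by the inclusion of open sets. -/
def overlap (O : ι → Opens X) {n : ℕ} (a : Fin (n + 1) → ι) : Opens X :=
  ⟨⋂ i, (O (a i) : Set X), isOpen_iInter_of_finite fun i => (O (a i)).isOpen⟩

/-- The inclusion of overlaps induced by a map of index sets. -/
def overlapMap (O : ι → Opens X) {n m : ℕ} (a : Fin (n + 1) → ι) (θ : Fin (m + 1) → Fin (n + 1))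
    (x : overlap O a) : overlap O (a ∘ θ) :=
  ⟨x, Set.mem_iInter.2 fun i => Set.mem_iInter.1 x.2 (θ i)⟩

/-- The inclusion of a smaller open set into a larger one. -/
def incl {U V : Opens X} (h : U ≤ V) (x : U) : V := ⟨x, h x.2⟩

/-- A (normalized) cocycle of a crossed module bundle gerbe. The maps `d_{αβ}` and `h_{αβγ}` are
given on the overlaps only: their values elsewhere are never used. -/
structure Cocycle (E : Type*) [NormedAddCommGroup E] [NormedSpace ℝ E]
    {X : Type*} [TopologicalSpace X] [ChartedSpace E X]
    (𝔛 : CrossedModule ED EH D H) (O : ι → Opens X) where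
  d : ι → ι → X → D
  h : ι → ι → ι → X → H
  smooth_d : ∀ α β, ContMDiffOn 𝓘(ℝ, E) 𝓘(ℝ, ED) ∞ (d α β) (O α ⊓ O β : Opens X)
  smooth_h : ∀ α β γ, ContMDiffOn 𝓘(ℝ, E) 𝓘(ℝ, EH) ∞ (h α β γ) (O α ⊓ O β ⊓ O γ : Opens X)
  cocycle_d : ∀ α β γ, ∀ x ∈ O α ⊓ O β ⊓ O γ,
    d α β x * d β γ x = 𝔛.bdry (h α β γ x) * d α γ x
  cocycle_h : ∀ α β γ δ, ∀ x ∈ O α ⊓ O β ⊓ O γ ⊓ O δ,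
    h α β γ x * h α γ δ x = 𝔛.act (d α β x) (h β γ δ x) * h α β δ x
  /-- Normalization. It implies `d_{αα} = 1` and `h_{ααβ} = h_{αββ} = 1`. -/
  normalized : ∀ α, ∀ x ∈ O α, h α α α x = 1

variable {𝔛 : CrossedModule ED EH D H} {O : ι → Opens X}

/-- A connection on the crossed module bundle gerbe with the given cocycle. -/
@[ext] structure GerbeConnection (c : Cocycle E 𝔛 O) where
  A : ∀ α, OneForm 𝓘(ℝ, E) (O α) 𝓘(ℝ, ED) D
  a : ∀ α β, OneForm 𝓘(ℝ, E) (O α ⊓ O β : Opens X) 𝓘(ℝ, EH) H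
  /-- `A_α + α(a_{αβ}) = d_{αβ} A_β d_{αβ}⁻¹ + d_{αβ} d(d_{αβ}⁻¹)` on `O_α ∩ O_β` -/
  transform_A : ∀ α β (x : (O α ⊓ O β : Opens X)),
    (A α).pull (I₂ := 𝓘(ℝ, E)) (incl inf_le_left) x +
        (lieMap 𝓘(ℝ, EH) 𝓘(ℝ, ED) 𝔛.bdry).comp ((a α β).toFun x) =
      (Ad 𝓘(ℝ, ED) (c.d α β x)).comp ((A β).pull (I₂ := 𝓘(ℝ, E)) (incl inf_le_right) x) +
        mulDInv 𝓘(ℝ, ED) 𝓘(ℝ, E) (fun y : (O α ⊓ O β : Opens X) => c.d α β y) x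
  /-- `a_{αβ} + ᵈa_{βγ} = h a_{αγ} h⁻¹ + h d(h⁻¹) + T_{A_α}(h)` on `O_α ∩ O_β ∩ O_γ`, where
  `d = d_{αβ}` and `h = h_{αβγ}` -/
  transform_a : ∀ α β γ (x : (O α ⊓ O β ⊓ O γ : Opens X)),
    (a α β).pull (I₂ := 𝓘(ℝ, E)) (incl inf_le_left) x +
        (𝔛.actLie (c.d α β x)).comp ((a β γ).pull (I₂ := 𝓘(ℝ, E))
          (incl (inf_le_inf_right _ inf_le_right)) x) =
      (Ad 𝓘(ℝ, EH) (c.h α β γ x)).comp ((a α γ).pull (I₂ := 𝓘(ℝ, E))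
          (incl (inf_le_inf_right _ inf_le_left)) x) +
        mulDInv 𝓘(ℝ, EH) 𝓘(ℝ, E) (fun y : (O α ⊓ O β ⊓ O γ : Opens X) => c.h α β γ y) x +
        (𝔛.T (c.h α β γ x)).comp ((A α).pull (I₂ := 𝓘(ℝ, E))
          (incl (inf_le_left.trans inf_le_left)) x)

namespace Cocycle

variable (c : Cocycle E 𝔛 O)

/-- The twisting function `τ` of the cocycle, from the component `a = (α₀, …, αₙ₊₁)` of the
`(n+1)`-simplices to `N_n C_{(H → D)}`. The simplex `τ(x)` has the vertices
`d_{α₀αₖ₊₁} d_{α₁αₖ₊₁}⁻¹` and the edges `h_{α₀α₁αᵢ₊₁}⁻¹ h_{α₀α₁αⱼ₊₁}`. In particular it is `d_{αβ}`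
for `n = 0` and `h_{αβγ} : d_{αγ} d_{βγ}⁻¹ → d_{αβ}` for `n = 1`. -/
def twist {n : ℕ} (a : Fin (n + 2) → ι) (x : X) : 𝔛.Nerve n :=
  CrossedModule.Nerve.mk
    (fun k => c.d (a 0) (a k.succ) x * (c.d (a 1) (a k.succ) x)⁻¹)
    (fun i j => (c.h (a 0) (a 1) (a i.succ) x)⁻¹ * c.h (a 0) (a 1) (a j.succ) x)

theorem mem_overlap {n : ℕ} {a : Fin (n + 1) → ι} {x : X} :
    x ∈ overlap O a ↔ ∀ i, x ∈ O (a i) := Set.mem_iInter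

theorem d_self {α : ι} {x : X} (hx : x ∈ O α) : c.d α α x = 1 := by
  simpa [c.normalized α x hx] using c.cocycle_d α α α x ⟨⟨hx, hx⟩, hx⟩

theorem h_self_left {α β : ι} {x : X} (hα : x ∈ O α) (hβ : x ∈ O β) : c.h α α β x = 1 := by
  simpa [c.normalized α x hα, c.d_self hα] using c.cocycle_h α α α β x ⟨⟨⟨hα, hα⟩, hα⟩, hβ⟩

theorem h_self_right {α β : ι} {x : X} (hα : x ∈ O α) (hβ : x ∈ O β) : c.h α β β x = 1 := by
  simpa [c.normalized β x hβ] using c.cocycle_h α β β β x ⟨⟨⟨hα, hβ⟩, hβ⟩, hβ⟩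

theorem obj_twist {n : ℕ} {a : Fin (n + 2) → ι} {x : X} (hx : x ∈ overlap O a)
    (k : Fin (n + 1)) :
    (c.twist a x).obj k = c.d (a 0) (a k.succ) x * (c.d (a 1) (a k.succ) x)⁻¹ := by
  rw [mem_overlap] at hx
  refine CrossedModule.Nerve.obj_mk (fun i j => ?_) (fun i j k => by group) k
  have key : ∀ i : Fin (n + 1), 𝔛.bdry (c.h (a 0) (a 1) (a i.succ) x) *
      (c.d (a 0) (a i.succ) x * (c.d (a 1) (a i.succ) x)⁻¹) = c.d (a 0) (a 1) x := fun i => by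
    rw [← mul_assoc, ← c.cocycle_d _ _ _ x ⟨⟨hx _, hx _⟩, hx _⟩, mul_inv_cancel_right]
  rw [map_mul, map_inv, mul_assoc, key, inv_mul_eq_iff_eq_mul, key]

theorem hom_twist {n : ℕ} (a : Fin (n + 2) → ι) (x : X) (i j : Fin (n + 1)) :
    (c.twist a x).hom i j =
      (c.h (a 0) (a 1) (a i.succ) x)⁻¹ * c.h (a 0) (a 1) (a j.succ) x :=
  CrossedModule.Nerve.hom_mk _ (fun i j k => by group) i j

theorem overlap_comp {n m : ℕ} {a : Fin (n + 1) → ι} {x : X} (hx : x ∈ overlap O a)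
    (θ : Fin (m + 1) → Fin (n + 1)) : x ∈ overlap O (a ∘ θ) :=
  mem_overlap.2 fun i => mem_overlap.1 hx (θ i)

/-- `∂₀τ(x) = τ(∂₁x) τ(∂₀x)⁻¹` -/
theorem face_zero_twist {n : ℕ} {a : Fin (n + 3) → ι} {x : X} (hx : x ∈ overlap O a) :
    (c.twist a x).face 0 =
      c.twist (a ∘ Fin.succAbove 1) x * (c.twist (a ∘ Fin.succAbove 0) x)⁻¹ := by
  rw [eq_mul_inv_iff_mul_eq]
  have hx' := mem_overlap.1 hx
  refine CrossedModule.Nerve.ext_obj_hom (fun i => ?_) (fun i j => ?_)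
  · rw [CrossedModule.Nerve.obj_mul, CrossedModule.Nerve.face, CrossedModule.Nerve.obj_map,
      c.obj_twist hx, c.obj_twist (overlap_comp hx _), c.obj_twist (overlap_comp hx _)]
    change c.d (a 0) (a i.succ.succ) x * (c.d (a 1) (a i.succ.succ) x)⁻¹ *
        (c.d (a 1) (a i.succ.succ) x * (c.d (a 2) (a i.succ.succ) x)⁻¹) =
      c.d (a 0) (a i.succ.succ) x * (c.d (a 2) (a i.succ.succ) x)⁻¹
    group
  · rw [CrossedModule.Nerve.hom_mul, CrossedModule.Nerve.face, CrossedModule.Nerve.obj_map,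
      CrossedModule.Nerve.hom_map, c.obj_twist hx, hom_twist, hom_twist, hom_twist]
    change (c.h (a 0) (a 1) (a i.succ.succ) x)⁻¹ * c.h (a 0) (a 1) (a j.succ.succ) x *
        𝔛.act (c.d (a 0) (a j.succ.succ) x * (c.d (a 1) (a j.succ.succ) x)⁻¹)
          ((c.h (a 1) (a 2) (a i.succ.succ) x)⁻¹ * c.h (a 1) (a 2) (a j.succ.succ) x) =
      (c.h (a 0) (a 2) (a i.succ.succ) x)⁻¹ * c.h (a 0) (a 2) (a j.succ.succ) x
    have key : ∀ k : Fin (n + 3), c.h (a 0) (a 2) (a k) x = (c.h (a 0) (a 1) (a 2) x)⁻¹ *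
        (𝔛.act (c.d (a 0) (a 1) x) (c.h (a 1) (a 2) (a k) x) * c.h (a 0) (a 1) (a k) x) :=
      fun k => by
        rw [eq_inv_mul_iff_mul_eq]
        exact c.cocycle_h _ _ _ _ x ⟨⟨⟨hx' _, hx' _⟩, hx' _⟩, hx' _⟩
    have hd : c.d (a 0) (a j.succ.succ) x * (c.d (a 1) (a j.succ.succ) x)⁻¹ =
        𝔛.bdry (c.h (a 0) (a 1) (a j.succ.succ) x)⁻¹ * c.d (a 0) (a 1) x := by
      rw [_root_.map_inv, eq_inv_mul_iff_mul_eq, ← mul_assoc,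
        ← c.cocycle_d _ _ _ x ⟨⟨hx' _, hx' _⟩, hx' _⟩, mul_inv_cancel_right]
    rw [hd, key, key, _root_.map_mul 𝔛.act, MulAut.mul_apply, 𝔛.peiffer, _root_.map_mul,
      _root_.map_inv]
    group

/-- `∂ᵢτ(x) = τ(∂ᵢ₊₁x)` for `i > 0` -/
theorem face_twist {n : ℕ} {a : Fin (n + 3) → ι} {x : X} (hx : x ∈ overlap O a)
    {i : Fin (n + 2)} (hi : i ≠ 0) :
    (c.twist a x).face i = c.twist (a ∘ i.succ.succAbove) x := by
  have e1 : (i.succ.succAbove 1 : Fin (n + 3)) = 1 := by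
    rw [← Fin.succ_zero_eq_one, Fin.succ_succAbove_succ, Fin.succAbove_ne_zero_zero hi]
    rfl
  refine CrossedModule.Nerve.ext_obj_hom (fun k => ?_) (fun k l => ?_)
  · rw [CrossedModule.Nerve.face, CrossedModule.Nerve.obj_map, c.obj_twist hx,
      c.obj_twist (overlap_comp hx _)]
    simp only [Function.comp, e1, Fin.succ_succAbove_succ, Fin.succ_succAbove_zero]
  · rw [CrossedModule.Nerve.face, CrossedModule.Nerve.hom_map, hom_twist, hom_twist]
    simp only [Function.comp, e1, Fin.succ_succAbove_succ, Fin.succ_succAbove_zero]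

/-- `sᵢτ(x) = τ(sᵢ₊₁x)` -/
theorem degen_twist {n : ℕ} {a : Fin (n + 2) → ι} {x : X} (hx : x ∈ overlap O a)
    (i : Fin (n + 1)) :
    (c.twist a x).degen i = c.twist (a ∘ i.succ.predAbove) x := by
  have e0 : (i.succ.predAbove 0 : Fin (n + 2)) = 0 := Fin.predAbove_right_zero
  have e1 : (i.succ.predAbove 1 : Fin (n + 2)) = 1 := by
    rw [← Fin.succ_zero_eq_one, Fin.succ_predAbove_succ, Fin.predAbove_right_zero]
    rfl
  refine CrossedModule.Nerve.ext_obj_hom (fun k => ?_) (fun k l => ?_)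
  · rw [CrossedModule.Nerve.degen, CrossedModule.Nerve.obj_map, c.obj_twist hx,
      c.obj_twist (overlap_comp hx _)]
    simp only [Function.comp, e0, e1, Fin.succ_predAbove_succ]
  · rw [CrossedModule.Nerve.degen, CrossedModule.Nerve.hom_map, hom_twist, hom_twist]
    simp only [Function.comp, e0, e1, Fin.succ_predAbove_succ]

/-- `τ(s₀x) = 1` -/
theorem twist_degen_zero {n : ℕ} {a : Fin (n + 1) → ι} {x : X} (hx : x ∈ overlap O a) :
    c.twist (a ∘ Fin.predAbove 0) x = 1 := by
  have hx' := mem_overlap.1 hx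
  refine Prod.ext ?_ (funext fun k => ?_)
  · change c.d (a 0) (a (Fin.last n)) x * (c.d (a 0) (a (Fin.last n)) x)⁻¹ = 1
    exact mul_inv_cancel _
  · change (c.h (a 0) (a 0) (a k.castSucc) x)⁻¹ * c.h (a 0) (a 0) (a (Fin.last n)) x = 1
    rw [c.h_self_left (hx' _) (hx' _), c.h_self_left (hx' _) (hx' _), inv_one, one_mul]

/-- `τ = d_{αβ}` on the edges. -/
theorem twist_zero (α β : ι) {x : X} (hx : x ∈ O β) : c.twist ![α, β] x = (c.d α β x, ![]) := by
  refine Prod.ext ?_ (funext fun k => k.elim0)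
  change c.d α β x * (c.d β β x)⁻¹ = c.d α β x
  rw [c.d_self hx, inv_one, mul_one]

/-- `τ` is `h_{αβγ} : d_{αγ} d_{βγ}⁻¹ → d_{αβ}` on the triangles. -/
theorem twist_one (α β γ : ι) {x : X} (hα : x ∈ O α) (hβ : x ∈ O β) :
    c.twist ![α, β, γ] x = (c.d α γ x * (c.d β γ x)⁻¹, ![c.h α β γ x]) := by
  refine Prod.ext rfl (funext fun k => ?_)
  obtain rfl : k = 0 := Fin.fin_one_eq_zero k
  change (c.h α β β x)⁻¹ * c.h α β γ x = c.h α β γ x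
  rw [c.h_self_right hα hβ, inv_one, one_mul]

/-- The twisting function is smooth. -/
theorem smooth_twist {n : ℕ} (a : Fin (n + 2) → ι) :
    ContMDiff 𝓘(ℝ, E) (𝓘(ℝ, ED).prod 𝓘(ℝ, Fin n → EH)) ∞
      (fun x : overlap O a => c.twist a (x : X)) := by
  have hd : ∀ i j, ContMDiff 𝓘(ℝ, E) 𝓘(ℝ, ED) ∞
      (fun x : overlap O a => c.d (a i) (a j) x) := fun i j =>
    (c.smooth_d (a i) (a j)).comp_contMDiff contMDiff_subtype_val
      fun x => ⟨mem_overlap.1 x.2 i, mem_overlap.1 x.2 j⟩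
  have hh : ∀ i j k, ContMDiff 𝓘(ℝ, E) 𝓘(ℝ, EH) ∞
      (fun x : overlap O a => c.h (a i) (a j) (a k) x) := fun i j k =>
    (c.smooth_h (a i) (a j) (a k)).comp_contMDiff contMDiff_subtype_val
      fun x => ⟨⟨mem_overlap.1 x.2 i, mem_overlap.1 x.2 j⟩, mem_overlap.1 x.2 k⟩
  exact CrossedModule.Nerve.contMDiff_iff.2
    ⟨(hd _ _).mul (hd _ _).inv, fun k => (hh _ _ _).inv.mul (hh _ _ _)⟩

/-- The component `a` of the total space `P_n = N_n C_{(H → D)} × X_n` of the principal bundle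
over the nerve `X` of the Čech groupoid. -/
abbrev Total (_c : Cocycle E 𝔛 O) {n : ℕ} (a : Fin (n + 1) → ι) : Type _ :=
  𝔛.Nerve n × overlap O a

/-- The face maps of the twisted product: `∂ᵢ(g, x) = (∂ᵢg, ∂ᵢx)` for `i > 0` and
`∂₀(g, x) = (∂₀g · τ(x), ∂₀x)`. -/
def totalFace {n : ℕ} (a : Fin (n + 2) → ι) (i : Fin (n + 2)) (p : c.Total a) :
    c.Total (a ∘ i.succAbove) :=
  (if i = 0 then p.1.face 0 * c.twist a p.2 else p.1.face i, overlapMap O a i.succAbove p.2)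

/-- The degeneracy maps `sᵢ(g, x) = (sᵢg, sᵢx)` of the twisted product. -/
def totalDegen {n : ℕ} (a : Fin (n + 1) → ι) (i : Fin (n + 1)) (p : c.Total a) :
    c.Total (a ∘ i.predAbove) :=
  (p.1.degen i, overlapMap O a i.predAbove p.2)

end Cocycle

/-- The model with corners of the Lie group `N_n C_{(H → D)}`. -/
abbrev modelN (ED EH : Type*) [NormedAddCommGroup ED] [NormedSpace ℝ ED]
    [NormedAddCommGroup EH] [NormedSpace ℝ EH] (n : ℕ) :
    ModelWithCorners ℝ (ED × (Fin n → EH)) (ModelProd ED (Fin n → EH)) :=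
  𝓘(ℝ, ED).prod 𝓘(ℝ, Fin n → EH)

/-- A simplicial connection on the principal `N C_{(H → D)}`-bundle of the cocycle. -/
@[ext] structure SimplicialConnection (c : Cocycle E 𝔛 O) where
  /-- The form on the component `a` of `P_n`, with values in `Lie(N_n C_{(H → D)})`. -/
  form : ∀ {n : ℕ} (a : Fin (n + 1) → ι),
    OneForm ((modelN ED EH n).prod 𝓘(ℝ, E)) (c.Total a) (modelN ED EH n) (𝔛.Nerve n)
  /-- `∂ᵢ^* 𝒜 = ∂ᵢ 𝒜` -/
  face : ∀ {n : ℕ} (a : Fin (n + 2) → ι) (i : Fin (n + 2)) (p : c.Total a),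
    (form (a ∘ i.succAbove)).pull (I₂ := (modelN ED EH (n + 1)).prod 𝓘(ℝ, E))
        (c.totalFace a i) p =
      (lieMap (modelN ED EH (n + 1)) (modelN ED EH n)
        (CrossedModule.Nerve.face (𝔛 := 𝔛) i)).comp ((form a).toFun p)
  /-- `sᵢ^* 𝒜 = sᵢ 𝒜` -/
  degen : ∀ {n : ℕ} (a : Fin (n + 1) → ι) (i : Fin (n + 1)) (p : c.Total a),
    (form (a ∘ i.predAbove)).pull (I₂ := (modelN ED EH n).prod 𝓘(ℝ, E)) (c.totalDegen a i) p =
      (lieMap (modelN ED EH n) (modelN ED EH (n + 1))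
        (CrossedModule.Nerve.degen (𝔛 := 𝔛) i)).comp ((form a).toFun p)
  /-- `g^* 𝒜 = g 𝒜 g⁻¹` for the left action of the structure group -/
  equivariant : ∀ {n : ℕ} (a : Fin (n + 1) → ι) (g : 𝔛.Nerve n) (p : c.Total a),
    (form a).pull (I₂ := (modelN ED EH n).prod 𝓘(ℝ, E))
        (fun q : c.Total a => ((g * q.1, q.2) : c.Total a)) p =
      (Ad (modelN ED EH n) g).comp ((form a).toFun p)
  /-- The restriction of `𝒜` to a fibre is the Cartan-Maurer form `g dg⁻¹`. -/
  cartanMaurer : ∀ {n : ℕ} (a : Fin (n + 1) → ι) (x : overlap O a) (g : 𝔛.Nerve n),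
    (form a).pull (I₂ := modelN ED EH n)
        (fun k : 𝔛.Nerve n => ((k, x) : c.Total a)) g =
      mulDInv (modelN ED EH n) (modelN ED EH n) (fun k : 𝔛.Nerve n => k) g

variable {c : Cocycle E 𝔛 O}

/-- The canonical section `σ(x) = (1, x)` over the vertices `O_α`. -/
def section₀ (c : Cocycle E 𝔛 O) (α : ι) (x : O α) : c.Total (n := 0) ![α] :=
  (1, ⟨x, Set.mem_iInter.2 fun i => by
    obtain rfl : i = 0 := Fin.fin_one_eq_zero i
    exact x.2⟩)

/-- The canonical section `σ(x) = (1, x)` over the edges `O_α ∩ O_β`. -/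
def section₁ (c : Cocycle E 𝔛 O) (α β : ι) (x : (O α ⊓ O β : Opens X)) :
    c.Total (n := 1) ![α, β] :=
  (1, ⟨x, Set.mem_iInter.2 <| Fin.forall_fin_two.2 ⟨x.2.1, x.2.2⟩⟩)

/-- A simplicial connection and a gerbe connection correspond to each other if `A_α` is the
component over `O_α` of the local form `A₀ = σ^* 𝒜₀`, and `-a_{αβ}` is the component over
`O_α ∩ O_β` of the morphism part `a₀₁` of `A₁ = σ^* 𝒜₁ = (∂₀A₁ → ∂₁A₁)`. -/
def Corresponds (𝒜 : SimplicialConnection c) (G : GerbeConnection c) : Prop :=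
  (∀ α (x : O α), (G.A α).toFun x =
    (lieMap (modelN ED EH 0) 𝓘(ℝ, ED) (fun g : 𝔛.Nerve 0 => g.obj 0)).comp
      ((𝒜.form (n := 0) ![α]).pull (I₂ := 𝓘(ℝ, E)) (section₀ c α) x)) ∧
  ∀ α β (x : (O α ⊓ O β : Opens X)), (G.a α β).toFun x =
    -(lieMap (modelN ED EH 1) 𝓘(ℝ, EH) (fun g : 𝔛.Nerve 1 => g.hom 0 1)).comp
      ((𝒜.form (n := 1) ![α, β]).pull (I₂ := 𝓘(ℝ, E)) (section₁ c α β) x)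

end Gerbe

end CrossedGerbe

end

/-!
A simplicial connection is the same as a compatible family of local forms. By equivariance and the
normalization on the fibres, the component of `𝒜_n` over a simplex `a` of indices is
`g A g⁻¹ + g dg⁻¹` (`totalForm`, `SimplicialConnection.form_at`), where the local form `A` is the
pullback of `𝒜_n` along the section `x ↦ (1, x)` (`SimplicialConnection.loc`). Conversely, every
`totalForm` is equivariant and restricts to `g dg⁻¹` on the fibres. For forms of this type the
simplicial conditions are conditions on the local forms (`totalForm_comp_of_jetEq`,
`jetEq_of_totalForm_comp`): the degeneracies and the faces `∂_i` with `i > 0` reindex the local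
forms, and the face `∂₀` applies the gauge transformation by the twisting function `τ`.

The faces `∂_i` with `i > 0` compare an `n`-simplex of indices with its edges that start at the
first index. They force the local form over `(α₀, …, αₙ)` to be the chain in the Lie algebra of the
nerve with the vertices `A_{α₀} + α(a_{α₀αₖ})` and the edges `a_{α₀αᵢ} - a_{α₀αⱼ}`
(`SimplicialConnection.loc_eq`, `GerbeConnection.loc`). So everything is determined by `A_α` and
`a_{αβ}`, and for forms of this shape the condition on `∂₀` is equivalent to the two equations of a
gerbe connection (`Cocycle.jetEq_twist_iff`): the first vertex yields the equation for `A_α`, the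
edges yield the equation for `a_{αβ}`, and the other vertices follow from the boundary map.

Identities between Lie algebra valued forms are proved as equalities of one-jets of group valued
maps. A vector-valued linear map `L` is the derivative at `x` of some map `S` into the group with
`S x = 1`, and gauge transforming `L` by `w` amounts to forming `y ↦ w x * S y * (w y)⁻¹`, up to
first order (`HasDer`, `JetEq`). In this way the terms `T_Y(h)`, the adjoint actions
and the terms `f df⁻¹` are read off from identities in the group, as in `CrossedModule.hasDer_edge`.
Smoothness of the forms comes from the tangent maps of smooth maps (`contMDiff_Ad`,
`contMDiff_mulDInv`).
-/

noncomputable section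

namespace CrossedGerbe

/-! ### First-order calculus of maps into manifolds -/

section Calculus

variable {E : Type*} [NormedAddCommGroup E] [NormedSpace ℝ E]
  {B : Type*} [TopologicalSpace B] {I : ModelWithCorners ℝ E B}
  {M : Type*} [TopologicalSpace M] [ChartedSpace B M]
  {E₁ : Type*} [NormedAddCommGroup E₁] [NormedSpace ℝ E₁]
  {B₁ : Type*} [TopologicalSpace B₁] {I₁ : ModelWithCorners ℝ E₁ B₁}
  {K₁ : Type*} [TopologicalSpace K₁] [ChartedSpace B₁ K₁]
  {E₂ : Type*} [NormedAddCommGroup E₂] [NormedSpace ℝ E₂]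
  {B₂ : Type*} [TopologicalSpace B₂] {I₂ : ModelWithCorners ℝ E₂ B₂}
  {K₂ : Type*} [TopologicalSpace K₂] [ChartedSpace B₂ K₂]
  {E₃ : Type*} [NormedAddCommGroup E₃] [NormedSpace ℝ E₃]
  {B₃ : Type*} [TopologicalSpace B₃] {I₃ : ModelWithCorners ℝ E₃ B₃}
  {K₃ : Type*} [TopologicalSpace K₃] [ChartedSpace B₃ K₃]

variable (I I₁) in
/-- The map `f` has the derivative `L` at `x`, where `L` is regarded as a map of model spaces. All
tangent spaces at points of a manifold are the model space by definition, so that derivatives of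
maps with different values can be compared and added. -/
def HasDer (f : M → K₁) (x : M) (L : E →L[ℝ] E₁) : Prop := HasMFDerivAt I I₁ f x L

variable (I I₁) in
/-- The derivative of `f` at `x`, as a map of model spaces. -/
def der (f : M → K₁) (x : M) : E →L[ℝ] E₁ := mfderiv I I₁ f x

variable (I I₁) in
/-- Equality of the one-jets of two maps at `x`: both are differentiable at `x`, with the same
value and the same derivative. -/
def JetEq (x : M) (f g : M → K₁) : Prop :=
  f x = g x ∧ ∃ L : E →L[ℝ] E₁, HasDer I I₁ f x L ∧ HasDer I I₁ g x L

namespace HasDer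

variable {x : M} {f g : M → K₁} {L L' : E →L[ℝ] E₁}

theorem mdifferentiableAt (h : HasDer I I₁ f x L) : MDifferentiableAt I I₁ f x :=
  HasMFDerivAt.mdifferentiableAt h

theorem eq (h : HasDer I I₁ f x L) (h' : HasDer I I₁ f x L') : L = L' :=
  hasMFDerivAt_unique (I := I) (I' := I₁) h h'

theorem der_eq (h : HasDer I I₁ f x L) : der I I₁ f x = L :=
  HasMFDerivAt.mfderiv (I := I) (I' := I₁) h

theorem of_eventuallyEq (h : HasDer I I₁ f x L) (hg : g =ᶠ[𝓝 x] f) : HasDer I I₁ g x L :=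
  HasMFDerivAt.congr_of_eventuallyEq (I := I) (I' := I₁) h hg

theorem comp {F : K₁ → K₂} {L₂ : E₁ →L[ℝ] E₂} {y : K₁} (hF : HasDer I₁ I₂ F y L₂)
    (h : HasDer I I₁ f x L) (hy : f x = y) :
    HasDer I I₂ (fun z => F (f z)) x (L₂.comp L) := by
  subst hy
  exact HasMFDerivAt.comp (I := I) (I' := I₁) (I'' := I₂) x hF h

theorem const (y : K₁) (x : M) : HasDer I I₁ (fun _ => y) x 0 :=
  hasMFDerivAt_const (I := I) (I' := I₁) y x

theorem id (x : M) : HasDer I I (fun y : M => y) x (ContinuousLinearMap.id ℝ E) :=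
  hasMFDerivAt_id (I := I) x

theorem fst (p : K₁ × K₂) : HasDer (I₁.prod I₂) I₁ (fun q : K₁ × K₂ => q.1) p
    (ContinuousLinearMap.fst ℝ E₁ E₂) :=
  hasMFDerivAt_fst (I := I₁) (I' := I₂) p

theorem snd (p : K₁ × K₂) : HasDer (I₁.prod I₂) I₂ (fun q : K₁ × K₂ => q.2) p
    (ContinuousLinearMap.snd ℝ E₁ E₂) :=
  hasMFDerivAt_snd (I := I₁) (I' := I₂) p

theorem prodMk {f' : M → K₂} {L' : E →L[ℝ] E₂} (h : HasDer I I₁ f x L)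
    (h' : HasDer I I₂ f' x L') :
    HasDer I (I₁.prod I₂) (fun y => (f y, f' y)) x (L.prod L') :=
  HasMFDerivAt.prodMk (I := I) (I' := I₁) (I'' := I₂) h h'

end HasDer

theorem hasDer_der {x : M} {f : M → K₁} (h : MDifferentiableAt I I₁ f x) :
    HasDer I I₁ f x (der I I₁ f x) :=
  MDifferentiableAt.hasMFDerivAt h

theorem exists_hasDer {x : M} {f : M → K₁} (h : MDifferentiableAt I I₁ f x) :
    ∃ L, HasDer I I₁ f x L := ⟨_, hasDer_der h⟩

/-- The derivative of a map of two variables in terms of its partial derivatives. -/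
theorem HasDer.of_partial {F : K₁ × K₂ → K₃} {p : K₁ × K₂} {L₁ : E₁ →L[ℝ] E₃} {L₂ : E₂ →L[ℝ] E₃}
    (hF : MDifferentiableAt (I₁.prod I₂) I₃ F p)
    (h₁ : HasDer I₁ I₃ (fun y => F (y, p.2)) p.1 L₁)
    (h₂ : HasDer I₂ I₃ (fun y => F (p.1, y)) p.2 L₂) :
    HasDer (I₁.prod I₂) I₃ F p (L₁.coprod L₂) := by
  obtain ⟨L, hL⟩ := exists_hasDer hF
  have e₁ := h₁.eq (hL.comp ((HasDer.id (I := I₁) p.1).prodMk (HasDer.const (I₁ := I₂) p.2 p.1))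
    rfl)
  have e₂ := h₂.eq (hL.comp ((HasDer.const (I₁ := I₁) p.1 p.2).prodMk (HasDer.id (I := I₂) p.2))
    rfl)
  have : L = L₁.coprod L₂ := by
    ext v
    · simp [e₁]
    · simp [e₂]
  rwa [← this]

/-- The inclusion of an open subset is the identity on tangent spaces, because the preferred
charts of the subset are restrictions of those of the manifold. -/
theorem hasDer_val {U : Opens M} (x : U) :
    HasDer I I (fun y : U => (y : M)) x (ContinuousLinearMap.id ℝ E) := by
  refine ⟨continuous_subtype_val.continuousAt, ?_⟩
  refine (hasFDerivWithinAt_id _ _).congr_of_eventuallyEq ?_ (by simp; rfl)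
  have hx := extChartAt_target_mem_nhdsWithin (I := I) x
  filter_upwards [hx] with y hy
  have := (extChartAt I x).right_inv hy
  exact this

/-- A map into an open subset has the same derivative as a map into the manifold. -/
theorem HasDer.codRestrict {U : Opens K₁} {x : M} {f : M → U} {L : E →L[ℝ] E₁}
    (h : HasDer I I₁ (fun y => (f y : K₁)) x L) : HasDer I I₁ f x L := by
  refine ⟨Topology.IsInducing.subtypeVal.continuousAt_iff.2 h.1, h.2⟩

/-- Every continuous linear map is the derivative of some map with a given value. -/
theorem exists_hasDer_eq [IsManifold I 1 M] [IsManifold I₁ 1 K₁] [I₁.Boundaryless] (x : M) (y : K₁)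
    (L : E →L[ℝ] E₁) : ∃ f : M → K₁, f x = y ∧ HasDer I I₁ f x L := by
  have h₁ : HasDer I 𝓘(ℝ, E) (extChartAt I x) x (ContinuousLinearMap.id ℝ E) := by
    have h := hasDer_der (mdifferentiableAt_extChartAt (I := I) (mem_chart_source B x))
    rwa [der, mfderiv_extChartAt_self] at h
  have h₂ : HasDer 𝓘(ℝ, E₁) I₁ (extChartAt I₁ y).symm (extChartAt I₁ y y)
      (ContinuousLinearMap.id ℝ E₁) := by
    refine ⟨continuousAt_extChartAt_symm y, ?_⟩
    refine (hasFDerivWithinAt_id _ _).congr_of_eventuallyEq ?_ (by simp; rfl)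
    have hx := extChartAt_target_mem_nhds (I := I₁) y
    filter_upwards [mem_nhdsWithin_of_mem_nhds hx] with z hz
    simp only [writtenInExtChartAt, extChartAt_to_inv, Function.comp]
    exact (extChartAt I₁ y).right_inv hz
  have h₃ : HasDer 𝓘(ℝ, E) 𝓘(ℝ, E₁)
      (fun v => extChartAt I₁ y y + L (v - extChartAt I x x)) (extChartAt I x x) L := by
    refine HasFDerivAt.hasMFDerivAt ?_
    simp only [map_sub]
    exact (L.hasFDerivAt.sub_const _).const_add _
  refine ⟨fun z => (extChartAt I₁ y).symm
    (extChartAt I₁ y y + L (extChartAt I x z - extChartAt I x x)), by simp, ?_⟩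
  simpa using h₂.comp (h₃.comp h₁ rfl) (by simp)

namespace JetEq

variable {x : M} {f g k : M → K₁}

theorem left (h : JetEq I I₁ x f g) : MDifferentiableAt I I₁ f x :=
  let ⟨_, _, h, _⟩ := h; h.mdifferentiableAt

theorem refl (h : MDifferentiableAt I I₁ f x) : JetEq I I₁ x f f :=
  let ⟨L, hL⟩ := exists_hasDer h; ⟨Eq.refl _, L, hL, hL⟩

theorem symm (h : JetEq I I₁ x f g) : JetEq I I₁ x g f :=
  let ⟨e, L, h, h'⟩ := h; ⟨e.symm, L, h', h⟩

theorem trans (h : JetEq I I₁ x f g) (h' : JetEq I I₁ x g k) : JetEq I I₁ x f k := by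
  obtain ⟨e, L, hf, hg⟩ := h
  obtain ⟨e', L', hg', hk⟩ := h'
  obtain rfl := hg.eq hg'
  exact ⟨e.trans e', L, hf, hk⟩

theorem hasDer (h : JetEq I I₁ x f g) {L : E →L[ℝ] E₁} (hg : HasDer I I₁ g x L) :
    HasDer I I₁ f x L := by
  obtain ⟨e, L', hf, hg'⟩ := h
  rwa [hg.eq hg']

theorem of_hasDer {L L' : E →L[ℝ] E₁} (hf : HasDer I I₁ f x L) (hg : HasDer I I₁ g x L')
    (e : f x = g x) (h : L = L') : JetEq I I₁ x f g :=
  ⟨e, L', h ▸ hf, hg⟩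

theorem of_eventuallyEq (h : MDifferentiableAt I I₁ f x) (hg : g =ᶠ[𝓝 x] f) :
    JetEq I I₁ x g f :=
  let ⟨L, hL⟩ := exists_hasDer h; ⟨hg.eq_of_nhds, L, hL.of_eventuallyEq hg, hL⟩

theorem comp (h : JetEq I I₁ x f g) {F : K₁ → K₂} (hF : MDifferentiableAt I₁ I₂ F (f x)) :
    JetEq I I₂ x (fun y => F (f y)) (fun y => F (g y)) := by
  obtain ⟨e, L, hf, hg⟩ := h
  obtain ⟨L', hF⟩ := exists_hasDer hF
  exact ⟨congrArg F e, _, hF.comp hf (Eq.refl _), hF.comp hg e.symm⟩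

theorem precomp {y : M} {f g : M → K₁} {φ : K₂ → M} {z : K₂} (h : JetEq I I₁ y f g)
    (hφ : MDifferentiableAt I₂ I φ z) (hy : φ z = y) :
    JetEq I₂ I₁ z (fun w => f (φ w)) (fun w => g (φ w)) := by
  subst hy
  obtain ⟨e, L, hf, hg⟩ := h
  obtain ⟨L', hφ⟩ := exists_hasDer hφ
  exact ⟨e, _, hf.comp hφ (Eq.refl _), hg.comp hφ (Eq.refl _)⟩

theorem prodMk {f' g' : M → K₂} (h : JetEq I I₁ x f g) (h' : JetEq I I₂ x f' g') :
    JetEq I (I₁.prod I₂) x (fun y => (f y, f' y)) (fun y => (g y, g' y)) := by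
  obtain ⟨e, L, hf, hg⟩ := h
  obtain ⟨e', L', hf', hg'⟩ := h'
  exact ⟨Prod.ext e e', _, hf.prodMk hf', hg.prodMk hg'⟩

end JetEq

end Calculus

/-! ### Differentiation in Lie groups -/

section LieGroups

variable {E : Type*} [NormedAddCommGroup E] [NormedSpace ℝ E]
  {B : Type*} [TopologicalSpace B] {I : ModelWithCorners ℝ E B}
  {M : Type*} [TopologicalSpace M] [ChartedSpace B M]
  {E₁ : Type*} [NormedAddCommGroup E₁] [NormedSpace ℝ E₁]
  {B₁ : Type*} [TopologicalSpace B₁] {I₁ : ModelWithCorners ℝ E₁ B₁}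
  {G : Type*} [TopologicalSpace G] [ChartedSpace B₁ G] [Group G] [LieGroup I₁ ∞ G]
  {E₂ : Type*} [NormedAddCommGroup E₂] [NormedSpace ℝ E₂]
  {B₂ : Type*} [TopologicalSpace B₂] {I₂ : ModelWithCorners ℝ E₂ B₂}
  {G₂ : Type*} [TopologicalSpace G₂] [ChartedSpace B₂ G₂] [Group G₂]
  {x : M}

/-! The maps of Lie algebras in the definitions of connections, as maps of model spaces. -/

variable (I₁ I₂) in
/-- The map `lieMap I₁ I₂ f` of Lie algebras, as a map of model spaces. -/
def dLie (f : G → G₂) : E₁ →L[ℝ] E₂ := lieMap I₁ I₂ f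

variable (I₁) in
/-- The adjoint action, as a map of model spaces. -/
def dAd (g : G) : E₁ →L[ℝ] E₁ := Ad I₁ g

variable (I I₁) in
/-- The value of the form `f d(f⁻¹)` at a point, as a map of model spaces. -/
def dMulDInv (f : M → G) (x : M) : E →L[ℝ] E₁ := mulDInv I₁ I f x

theorem mdifferentiable_mul_pair :
    MDifferentiable (I₁.prod I₁) I₁ (fun p : G × G => p.1 * p.2) :=
  (contMDiff_mul I₁ ∞).mdifferentiable (by simp)

theorem mdifferentiable_inv_group : MDifferentiable I₁ I₁ (fun g : G => g⁻¹) :=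
  (contMDiff_inv I₁ ∞).mdifferentiable (by simp)

theorem _root_.MDifferentiableAt.mul_group {f g : M → G} (hf : MDifferentiableAt I I₁ f x)
    (hg : MDifferentiableAt I I₁ g x) : MDifferentiableAt I I₁ (fun y => f y * g y) x :=
  (mdifferentiable_mul_pair (I₁ := I₁) (f x, g x)).comp x (hf.prodMk hg)

theorem _root_.MDifferentiableAt.inv_group {f : M → G} (hf : MDifferentiableAt I I₁ f x) :
    MDifferentiableAt I I₁ (fun y => (f y)⁻¹) x :=
  (mdifferentiable_inv_group (I₁ := I₁) (f x)).comp x hf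

namespace JetEq

variable {f f' g g' : M → G}

theorem mul (h : JetEq I I₁ x f f') (h' : JetEq I I₁ x g g') :
    JetEq I I₁ x (fun y => f y * g y) (fun y => f' y * g' y) :=
  (h.prodMk h').comp (F := fun p : G × G => p.1 * p.2) (mdifferentiable_mul_pair _)

theorem inv (h : JetEq I I₁ x f f') : JetEq I I₁ x (fun y => (f y)⁻¹) (fun y => (f' y)⁻¹) :=
  h.comp (mdifferentiable_inv_group _)

end JetEq

namespace HasDer

variable {f g : M → G} {L L' : E →L[ℝ] E₁}

theorem mul_one_one (hf : HasDer I I₁ f x L) (hg : HasDer I I₁ g x L') (hf1 : f x = 1)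
    (hg1 : g x = 1) : HasDer I I₁ (fun y => f y * g y) x (L + L') := by
  have h : HasDer (I₁.prod I₁) I₁ (fun p : G × G => p.1 * p.2) (1, 1)
      ((ContinuousLinearMap.id ℝ E₁).coprod (ContinuousLinearMap.id ℝ E₁)) := by
    refine HasDer.of_partial (mdifferentiable_mul_pair _) ?_ ?_
    · simpa using HasDer.id (I := I₁) (1 : G)
    · simpa using HasDer.id (I := I₁) (1 : G)
  have := h.comp (hf.prodMk hg) (by simp [hf1, hg1])
  convert this using 1
  ext v; simp

theorem inv_one (hf : HasDer I I₁ f x L) (hf1 : f x = 1) :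
    HasDer I I₁ (fun y => (f y)⁻¹) x (-L) := by
  obtain ⟨L', h'⟩ := exists_hasDer hf.mdifferentiableAt.inv_group
  have h := hf.mul_one_one h' hf1 (by simp [hf1])
  simp only [mul_inv_cancel] at h
  rwa [neg_eq_of_add_eq_zero_right (h.eq (HasDer.const _ x))]

theorem lieMap {f : G → G₂} (hf : MDifferentiableAt I₁ I₂ f 1) {F : M → G}
    (hF : HasDer I I₁ F x L) (h1 : F x = 1) :
    HasDer I I₂ (fun y => f (F y)) x
      ((dLie I₁ I₂ f).comp L) :=
  (hasDer_der hf).comp hF h1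

theorem conj (g : G) {F : M → G} (hF : HasDer I I₁ F x L) (h1 : F x = 1) :
    HasDer I I₁ (fun y => g * F y * g⁻¹) x ((dAd I₁ g).comp L) :=
  HasDer.lieMap (I₂ := I₁) (f := fun k : G => g * k * g⁻¹)
    ((mdifferentiableAt_const.mul_group mdifferentiableAt_id).mul_group mdifferentiableAt_const)
    hF h1

end HasDer

theorem hasDer_mulDInv {f : M → G} (hf : MDifferentiableAt I I₁ f x) :
    HasDer I I₁ (fun y => f x * (f y)⁻¹) x (dMulDInv I I₁ f x) :=
  hasDer_der (mdifferentiableAt_const.mul_group hf.inv_group)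

end LieGroups

/-! ### Smoothness of Lie algebra valued maps -/

section Smooth

variable {E : Type*} [NormedAddCommGroup E] [NormedSpace ℝ E]
  {B : Type*} [TopologicalSpace B] {I : ModelWithCorners ℝ E B}
  {M : Type*} [TopologicalSpace M] [ChartedSpace B M]
  {E₁ : Type*} [NormedAddCommGroup E₁] [NormedSpace ℝ E₁]
  {B₁ : Type*} [TopologicalSpace B₁] {I₁ : ModelWithCorners ℝ E₁ B₁}
  {E₂ : Type*} [NormedAddCommGroup E₂] [NormedSpace ℝ E₂]
  {B₂ : Type*} [TopologicalSpace B₂] {I₂ : ModelWithCorners ℝ E₂ B₂}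

section Manifold

variable {K : Type*} [TopologicalSpace K] [ChartedSpace B₁ K] [IsManifold I₁ ∞ K]
  {N : Type*} [TopologicalSpace N] [ChartedSpace B₂ N] [IsManifold I₂ ∞ N]

theorem isManifold_one (I : ModelWithCorners ℝ E B) (M : Type*) [TopologicalSpace M]
    [ChartedSpace B M] [IsManifold I ∞ M] : IsManifold I 1 M :=
  .of_le (n := ∞) (by simp)

attribute [local instance] isManifold_one

theorem trivializationAt_self (y : K) (v : E₁) :
    (trivializationAt E₁ (TangentSpace I₁) y ⟨y, v⟩).2 = v := by
  rw [TangentBundle.trivializationAt_eq_localTriv]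
  exact (tangentBundleCore I₁ K).coordChange_self (achart B₁ y) y (mem_chart_source B₁ y) v

/-- A map into a fixed tangent space is smooth if and only if it is smooth as a map into the
tangent bundle. -/
theorem contMDiff_mk_iff (y : K) {f : M → E₁} :
    ContMDiff I I₁.tangent ∞ (fun x => (⟨y, f x⟩ : TangentBundle I₁ K)) ↔
      ContMDiff I 𝓘(ℝ, E₁) ∞ f := by
  refine forall_congr' fun x => ?_
  rw [Bundle.contMDiffAt_totalSpace]
  simp only [trivializationAt_self]
  exact and_iff_right contMDiffAt_const

theorem ContMDiff.snd_of_fst_eq {φ : M → TangentBundle I₁ K}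
    (hφ : ContMDiff I I₁.tangent ∞ φ) {y : K} (hy : ∀ x, (φ x).1 = y) {f : M → E₁}
    (hf : ∀ x, f x = (φ x).2) : ContMDiff I 𝓘(ℝ, E₁) ∞ f := by
  rw [← contMDiff_mk_iff (I₁ := I₁) y]
  convert hφ with x
  rw [hf, ← hy x]

theorem tangentMap_snd {f : K → N} {v : TangentBundle I₁ K} {L : E₁ →L[ℝ] E₂}
    (h : HasDer I₁ I₂ f v.1 L) : (tangentMap I₁ I₂ f v).2 = L v.2 := by
  rw [← h.der_eq]
  rfl

end Manifold

attribute [local instance] isManifold_one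

variable {G : Type*} [TopologicalSpace G] [ChartedSpace B₁ G] [Group G] [LieGroup I₁ ∞ G]

theorem hasDer_mul_inv_left (g : G) :
    HasDer I₁ I₁ (fun k => g * k⁻¹) g (dMulDInv I₁ I₁ (fun k : G => k) g) :=
  hasDer_mulDInv (f := fun k : G => k) mdifferentiableAt_id

theorem hasDer_conj (g : G) :
    HasDer I₁ I₁ (fun k => g * k * g⁻¹) 1 (dAd I₁ g) := by
  exact (HasDer.id (I := I₁) (1 : G)).conj g rfl

/-- The Cartan-Maurer form `g dg⁻¹` is smooth. -/
theorem contMDiff_mulDInv : ContMDiff (M := TangentBundle I₁ G) I₁.tangent 𝓘(ℝ, E₁) ∞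
    (fun v => dMulDInv I₁ I₁ (fun k : G => k) v.1 v.2) := by
  have : IsManifold I₁ 1 G := isManifold_one I₁ G
  have hF : ContMDiff (I₁.prod I₁) I₁ ∞ (fun p : G × G => p.1 * p.2⁻¹) :=
    contMDiff_fst.mul contMDiff_snd.inv
  have h₁ : ContMDiff (M := TangentBundle I₁ G) I₁.tangent I₁.tangent ∞
      (fun v => (⟨v.1, 0⟩ : TangentBundle I₁ G)) :=
    (Bundle.contMDiff_zeroSection ℝ (TangentSpace I₁)).comp
      (Bundle.contMDiff_proj (TangentSpace I₁))
  have h := (hF.contMDiff_tangentMap (m := ∞) le_rfl).comp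
    ((contMDiff_equivTangentBundleProd_symm (n := ∞)).comp (h₁.prodMk contMDiff_id))
  refine ContMDiff.snd_of_fst_eq h (y := 1) (fun v => mul_inv_cancel v.1) fun v => ?_
  obtain ⟨L, hL⟩ := exists_hasDer (hF.mdifferentiable (by simp) (v.1, v.1))
  rw [(hasDer_mul_inv_left (I₁ := I₁) v.1).eq
    (hL.comp ((HasDer.const (I₁ := I₁) v.1 v.1).prodMk (HasDer.id v.1)) rfl)]
  exact (tangentMap_snd (v := (equivTangentBundleProd I₁ G I₁ G).symm (⟨v.1, 0⟩, v)) hL).symm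

/-- The adjoint action is smooth. -/
theorem contMDiff_Ad : ContMDiff (I₁.prod 𝓘(ℝ, E₁)) 𝓘(ℝ, E₁) ∞
    (fun p : G × E₁ => dAd I₁ p.1 p.2) := by
  have : IsManifold I₁ 1 G := isManifold_one I₁ G
  have hF : ContMDiff (I₁.prod I₁) I₁ ∞ (fun p : G × G => p.1 * p.2 * p.1⁻¹) :=
    (contMDiff_fst.mul contMDiff_snd).mul contMDiff_fst.inv
  have h₁ : ContMDiff (I₁.prod 𝓘(ℝ, E₁)) I₁.tangent ∞
      (fun p : G × E₁ => (⟨p.1, 0⟩ : TangentBundle I₁ G)) :=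
    (Bundle.contMDiff_zeroSection ℝ (TangentSpace I₁)).comp contMDiff_fst
  have h₂ : ContMDiff (I₁.prod 𝓘(ℝ, E₁)) I₁.tangent ∞
      (fun p : G × E₁ => (⟨1, p.2⟩ : TangentBundle I₁ G)) :=
    (contMDiff_mk_iff 1).2 contMDiff_snd
  have h := (hF.contMDiff_tangentMap (m := ∞) le_rfl).comp
    ((contMDiff_equivTangentBundleProd_symm (n := ∞)).comp (h₁.prodMk h₂))
  refine ContMDiff.snd_of_fst_eq h (y := 1) (fun p => ?_) fun p => ?_
  · change p.1 * 1 * p.1⁻¹ = 1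
    simp
  obtain ⟨L, hL⟩ := exists_hasDer (hF.mdifferentiable (by simp) (p.1, 1))
  rw [(hasDer_conj (I₁ := I₁) p.1).eq
    (hL.comp ((HasDer.const (I₁ := I₁) p.1 (1 : G)).prodMk (HasDer.id (1 : G))) rfl)]
  exact (tangentMap_snd (v := (equivTangentBundleProd I₁ G I₁ G).symm (⟨p.1, 0⟩, ⟨1, p.2⟩)) hL).symm

variable {N : Type*} [TopologicalSpace N] [ChartedSpace B₂ N] [IsManifold I₂ ∞ N]
  [IsManifold I ∞ M]

/-- The value of a one-form at a point, as a map of model spaces. -/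
def OneForm.at (η : OneForm I M I₁ G) (x : M) : E →L[ℝ] E₁ := η.toFun x

variable (I₂) in
/-- The pullback of a one-form at a point, as a map of model spaces. -/
def OneForm.pullAt (η : OneForm I M I₁ G) (f : N → M) (x : N) : E₂ →L[ℝ] E₁ :=
  η.pull (I₂ := I₂) f x

/-- The pullback of a smooth form is smooth. -/
theorem OneForm.contMDiff_pull (η : OneForm I M I₁ G) {f : N → M} (hf : ContMDiff I₂ I ∞ f) :
    ContMDiff (M := TangentBundle I₂ N) I₂.tangent 𝓘(ℝ, E₁) ∞
      (fun v => η.pullAt I₂ f v.1 v.2) := by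
  have : IsManifold I 1 M := isManifold_one I M
  have : IsManifold I₂ 1 N := isManifold_one I₂ N
  exact η.smooth.comp (hf.contMDiff_tangentMap (m := ∞) le_rfl)

theorem OneForm.ext_at {η η' : OneForm I M I₁ G} (h : ∀ x, η.at x = η'.at x) : η = η' :=
  OneForm.ext (funext h)

theorem OneForm.pullAt_eq (η : OneForm I M I₁ G) {f : N → M} {x : N} {L : E₂ →L[ℝ] E}
    (hf : HasDer I₂ I f x L) : η.pullAt I₂ f x = (η.at (f x)).comp L := by
  rw [← hf.der_eq]
  rfl

end Smooth

/-! ### Differentiation in crossed modules and their nerves -/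

section CrossedCalculus

attribute [local instance] powChartedSpace

theorem hasDer_pow {E : Type*} [NormedAddCommGroup E] [NormedSpace ℝ E]
    {B : Type*} [TopologicalSpace B] {I : ModelWithCorners ℝ E B}
    {M : Type*} [TopologicalSpace M] [ChartedSpace B M]
    {F : Type*} [NormedAddCommGroup F] [NormedSpace ℝ F]
    {K : Type*} [TopologicalSpace K] [ChartedSpace F K] {n : ℕ} {f : M → Fin n → K} {x : M}
    {L : Fin n → E →L[ℝ] F} (h : ∀ k, HasDer I 𝓘(ℝ, F) (fun y => f y k) x (L k)) :
    HasDer I 𝓘(ℝ, Fin n → F) f x (ContinuousLinearMap.pi L) :=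
  ⟨continuousAt_pi.2 fun k => (h k).1, hasFDerivWithinAt_pi.2 fun k => (h k).2⟩

variable {ED EH D H : Type*}
  [NormedAddCommGroup ED] [NormedSpace ℝ ED] [NormedAddCommGroup EH] [NormedSpace ℝ EH]
  [TopologicalSpace D] [ChartedSpace ED D] [Group D] [LieGroup 𝓘(ℝ, ED) ∞ D]
  [TopologicalSpace H] [ChartedSpace EH H] [Group H] [LieGroup 𝓘(ℝ, EH) ∞ H]
  {𝔛 : CrossedModule ED EH D H}
  {E : Type*} [NormedAddCommGroup E] [NormedSpace ℝ E]
  {B : Type*} [TopologicalSpace B] {I : ModelWithCorners ℝ E B}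
  {M : Type*} [TopologicalSpace M] [ChartedSpace B M] {x : M}

namespace CrossedModule

theorem mdifferentiable_bdry : MDifferentiable 𝓘(ℝ, EH) 𝓘(ℝ, ED) 𝔛.bdry :=
  𝔛.smooth_bdry.mdifferentiable (by simp)

theorem mdifferentiable_act :
    MDifferentiable (𝓘(ℝ, ED).prod 𝓘(ℝ, EH)) 𝓘(ℝ, EH) (fun p : D × H => 𝔛.act p.1 p.2) :=
  𝔛.smooth_act.mdifferentiable (by simp)

theorem mdifferentiableAt_act {f : M → D} {g : M → H} (hf : MDifferentiableAt I 𝓘(ℝ, ED) f x)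
    (hg : MDifferentiableAt I 𝓘(ℝ, EH) g x) :
    MDifferentiableAt I 𝓘(ℝ, EH) (fun y => 𝔛.act (f y) (g y)) x :=
  (𝔛.mdifferentiable_act (f x, g x)).comp x (hf.prodMk hg)

theorem jetEq_bdry {g g' : M → H} (h : JetEq I 𝓘(ℝ, EH) x g g') :
    JetEq I 𝓘(ℝ, ED) x (fun y => 𝔛.bdry (g y)) (fun y => 𝔛.bdry (g' y)) :=
  h.comp (𝔛.mdifferentiable_bdry _)

theorem jetEq_act {f f' : M → D} {g g' : M → H} (hf : JetEq I 𝓘(ℝ, ED) x f f')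
    (hg : JetEq I 𝓘(ℝ, EH) x g g') :
    JetEq I 𝓘(ℝ, EH) x (fun y => 𝔛.act (f y) (g y)) (fun y => 𝔛.act (f' y) (g' y)) :=
  (hf.prodMk hg).comp (F := fun p : D × H => 𝔛.act p.1 p.2) (𝔛.mdifferentiable_act _)

/-- To first order, an element of `D` near `1` acts trivially on elements of `H` near `1`. -/
theorem jetEq_act_one {f : M → D} {g : M → H} (hf : MDifferentiableAt I 𝓘(ℝ, ED) f x)
    (hg : MDifferentiableAt I 𝓘(ℝ, EH) g x) (hf1 : f x = 1) (hg1 : g x = 1) :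
    JetEq I 𝓘(ℝ, EH) x (fun y => 𝔛.act (f y) (g y)) g := by
  have h : HasDer (𝓘(ℝ, ED).prod 𝓘(ℝ, EH)) 𝓘(ℝ, EH) (fun p : D × H => 𝔛.act p.1 p.2) (1, 1)
      ((0 : ED →L[ℝ] EH).coprod (ContinuousLinearMap.id ℝ EH)) := by
    refine HasDer.of_partial (𝔛.mdifferentiable_act _) ?_ ?_
    · simpa using HasDer.const (I := 𝓘(ℝ, ED)) (I₁ := 𝓘(ℝ, EH)) (1 : H) (1 : D)
    · simpa using HasDer.id (I := 𝓘(ℝ, EH)) (1 : H)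
  refine .of_hasDer (h.comp ((hasDer_der hf).prodMk (hasDer_der hg)) (by simp [hf1, hg1]))
    (hasDer_der hg) (by simp [hf1]) ?_
  ext v; simp

variable (𝔛) in
/-- The action `ᵈX` on the Lie algebra of `H`, as a map of model spaces. -/
def dActLie (d : D) : EH →L[ℝ] EH := 𝔛.actLie d

variable (𝔛) in
/-- The map `X ↦ T_X(h)`, as a map of model spaces. -/
def dT (h : H) : ED →L[ℝ] EH := 𝔛.T h

variable (𝔛) in
/-- The map of Lie algebras induced by `α : H → D`, as a map of model spaces. -/
def dBdry : EH →L[ℝ] ED := dLie 𝓘(ℝ, EH) 𝓘(ℝ, ED) 𝔛.bdry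

theorem hasDer_bdry {F : M → H} {L : E →L[ℝ] EH} (hF : HasDer I 𝓘(ℝ, EH) F x L) (h1 : F x = 1) :
    HasDer I 𝓘(ℝ, ED) (fun y => 𝔛.bdry (F y)) x (𝔛.dBdry.comp L) :=
  hF.lieMap (𝔛.mdifferentiable_bdry _) h1

theorem hasDer_act (d : D) {F : M → H} {L : E →L[ℝ] EH} (hF : HasDer I 𝓘(ℝ, EH) F x L)
    (h1 : F x = 1) : HasDer I 𝓘(ℝ, EH) (fun y => 𝔛.act d (F y)) x ((𝔛.dActLie d).comp L) :=
  hF.lieMap (f := fun h => 𝔛.act d h)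
    (mdifferentiableAt_act mdifferentiableAt_const mdifferentiableAt_id) h1

theorem hasDer_T (h : H) {F : M → D} {L : E →L[ℝ] ED} (hF : HasDer I 𝓘(ℝ, ED) F x L)
    (h1 : F x = 1) :
    HasDer I 𝓘(ℝ, EH) (fun y => h * 𝔛.act (F y) h⁻¹) x ((𝔛.dT h).comp L) :=
  hF.lieMap (f := fun d => h * 𝔛.act d h⁻¹) (mdifferentiableAt_const.mul_group
    (mdifferentiableAt_act mdifferentiableAt_id mdifferentiableAt_const)) h1

/-- The derivative of the edge that starts at the apex in the gauge transformed simplex (see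
`Cocycle.cone_gauge`), where `d x * A' y * (d y)⁻¹` is the apex. The hypothesis `hd` is the equation
of a gerbe connection for `A` and `A'`: it replaces the action of the apex on `h` by the action of
`A`, conjugated by `b`. -/
theorem hasDer_edge {A A' d : M → D} {b b' h : M → H} {L : E →L[ℝ] ED} {X X' : E →L[ℝ] EH}
    (hA : HasDer I 𝓘(ℝ, ED) A x L) (hA1 : A x = 1)
    (hb : HasDer I 𝓘(ℝ, EH) b x X) (hb1 : b x = 1)
    (hb' : HasDer I 𝓘(ℝ, EH) b' x X') (hb'1 : b' x = 1)
    (hh : MDifferentiableAt I 𝓘(ℝ, EH) h x)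
    (hd : JetEq I 𝓘(ℝ, ED) x (fun y => d x * A' y * (d y)⁻¹) (fun y => 𝔛.bdry (b y) * A y)) :
    HasDer I 𝓘(ℝ, EH)
      (fun y => (h x)⁻¹ * 𝔛.act (d x) (b' y) * 𝔛.act (d x * A' y * (d y)⁻¹) (h y)) x
      ((dAd 𝓘(ℝ, EH) (h x)⁻¹).comp ((𝔛.dActLie (d x)).comp X' + X -
        dMulDInv I 𝓘(ℝ, EH) h x - (𝔛.dT (h x)).comp L) - X) := by
  have hu := hasDer_mulDInv (I := I) hh
  have ht := 𝔛.hasDer_T (h x) hA hA1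
  have hy := 𝔛.hasDer_act (d x) hb' hb'1
  have hc : MDifferentiableAt I 𝓘(ℝ, EH) (fun _ => h x) x := mdifferentiableAt_const
  -- The element `h` is the product of `(h(x) h⁻¹)⁻¹`, on which `A` acts trivially to first order,
  -- and the constant `h(x)`.
  have e : JetEq I 𝓘(ℝ, EH) x (fun y => 𝔛.act (d x * A' y * (d y)⁻¹) (h y)) (fun y => b y *
      ((h x * (h y)⁻¹)⁻¹ * (h x * 𝔛.act (A y) (h x)⁻¹)⁻¹ * h x) * (b y)⁻¹) := by
    refine (jetEq_act hd (.refl hh)).trans ?_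
    have e₁ : JetEq I 𝓘(ℝ, EH) x (fun y => 𝔛.act (A y) (h x * (h y)⁻¹)⁻¹)
        (fun y => (h x * (h y)⁻¹)⁻¹) :=
      jetEq_act_one hA.mdifferentiableAt hu.mdifferentiableAt.inv_group hA1 (by simp)
    have hb := JetEq.refl hb.mdifferentiableAt
    have e₂ := (hb.mul (e₁.mul (jetEq_act (𝔛 := 𝔛) (.refl hA.mdifferentiableAt) (.refl hc)))).mul
      hb.inv
    convert e₂ using 2 with y y
    · simp [𝔛.peiffer]
    · simp [mul_assoc]
  have hq := (((hy.mul_one_one hb (by simp [hb'1]) hb1).mul_one_one (hu.inv_one (by simp))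
    (by simp [hb'1, hb1]) (by simp)).mul_one_one (ht.inv_one (by simp [hA1]))
    (by simp [hb'1, hb1]) (by simp [hA1]))
  have hf := (hq.conj (h x)⁻¹ (by simp [hb'1, hb1, hA1])).mul_one_one (hb.inv_one hb1)
    (by simp [hb'1, hb1, hA1]) (by simp [hb1])
  have hyd : MDifferentiableAt I 𝓘(ℝ, EH) (fun y => (h x)⁻¹ * 𝔛.act (d x) (b' y)) x :=
    mdifferentiableAt_const.mul_group hy.mdifferentiableAt
  refine ((JetEq.refl hyd).mul e).hasDer ?_
  convert hf using 1
  · funext y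
    group
  · simp only [sub_eq_add_neg]

end CrossedModule

namespace CrossedModule.Nerve

variable {n m : ℕ}

theorem hasDer_mk {f : M → 𝔛.Nerve n} {L : E →L[ℝ] ED} {L' : Fin n → E →L[ℝ] EH}
    (h : HasDer I 𝓘(ℝ, ED) (fun y => (f y).1) x L)
    (h' : ∀ k, HasDer I 𝓘(ℝ, EH) (fun y => (f y).2 k) x (L' k)) :
    HasDer I (modelN ED EH n) f x (L.prod (ContinuousLinearMap.pi L')) :=
  HasDer.prodMk (I₁ := 𝓘(ℝ, ED)) (I₂ := 𝓘(ℝ, Fin n → EH)) (K₁ := D) (K₂ := Fin n → H)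
    h (hasDer_pow h')

theorem jetEq_mk {f g : M → 𝔛.Nerve n}
    (h : JetEq I 𝓘(ℝ, ED) x (fun y => (f y).1) (fun y => (g y).1))
    (h' : ∀ k, JetEq I 𝓘(ℝ, EH) x (fun y => (f y).2 k) (fun y => (g y).2 k)) :
    JetEq I (modelN ED EH n) x f g := by
  obtain ⟨e, L, hf, hg⟩ := h
  choose e' L' hf' hg' using h'
  exact ⟨Prod.ext e (funext e'), _, hasDer_mk hf hf', hasDer_mk hg hg'⟩

theorem contMDiff_fst_snd : ContMDiff (modelN ED EH n) 𝓘(ℝ, ED) ∞ (fun g : 𝔛.Nerve n => g.1) ∧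
    ∀ k, ContMDiff (modelN ED EH n) 𝓘(ℝ, EH) ∞ (fun g : 𝔛.Nerve n => g.2 k) :=
  contMDiff_iff.1 contMDiff_id

theorem contMDiff_fromLast (k : Fin (n + 1)) :
    ContMDiff (modelN ED EH n) 𝓘(ℝ, EH) ∞ (fun g : 𝔛.Nerve n => g.fromLast k) := by
  refine Fin.lastCases ?_ (fun k => ?_) k
  · simpa [fromLast] using contMDiff_const
  · simpa [fromLast] using contMDiff_fst_snd.2 k

theorem contMDiff_obj (k : Fin (n + 1)) :
    ContMDiff (modelN ED EH n) 𝓘(ℝ, ED) ∞ (fun g : 𝔛.Nerve n => g.obj k) :=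
  (𝔛.smooth_bdry.comp (contMDiff_fromLast k)).mul contMDiff_fst_snd.1

theorem contMDiff_hom (i j : Fin (n + 1)) :
    ContMDiff (modelN ED EH n) 𝓘(ℝ, EH) ∞ (fun g : 𝔛.Nerve n => g.hom i j) :=
  (contMDiff_fromLast i).mul (contMDiff_fromLast j).inv

theorem contMDiff_map (θ : Fin (m + 1) → Fin (n + 1)) :
    ContMDiff (modelN ED EH n) (modelN ED EH m) ∞ (map (𝔛 := 𝔛) θ) :=
  contMDiff_iff.2 ⟨contMDiff_obj _, fun _ => contMDiff_hom _ _⟩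

theorem mdifferentiable_obj (k : Fin (n + 1)) :
    MDifferentiable (modelN ED EH n) 𝓘(ℝ, ED) (fun g : 𝔛.Nerve n => g.obj k) :=
  (contMDiff_obj k).mdifferentiable (by simp)

theorem mdifferentiable_hom (i j : Fin (n + 1)) :
    MDifferentiable (modelN ED EH n) 𝓘(ℝ, EH) (fun g : 𝔛.Nerve n => g.hom i j) :=
  (contMDiff_hom i j).mdifferentiable (by simp)

theorem mdifferentiable_map (θ : Fin (m + 1) → Fin (n + 1)) :
    MDifferentiable (modelN ED EH n) (modelN ED EH m) (map (𝔛 := 𝔛) θ) :=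
  (contMDiff_map θ).mdifferentiable (by simp)

/-- The simplex with the vertices `α(bₖ) e` and the edges `bᵢ bⱼ⁻¹`, which is the face opposite to
the apex of a cone with the apex `e` and the edges `bₖ : e → α(bₖ) e`. -/
def cone (e : D) (b : Fin (n + 1) → H) : 𝔛.Nerve n :=
  (𝔛.bdry (b (Fin.last n)) * e, fun k => b k.castSucc * (b (Fin.last n))⁻¹)

theorem fromLast_cone (e : D) (b : Fin (n + 1) → H) (k : Fin (n + 1)) :
    (cone e b : 𝔛.Nerve n).fromLast k = b k * (b (Fin.last n))⁻¹ := by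
  refine Fin.lastCases ?_ (fun k => ?_) k <;> simp [fromLast, cone]

theorem obj_cone (e : D) (b : Fin (n + 1) → H) (k : Fin (n + 1)) :
    (cone e b : 𝔛.Nerve n).obj k = 𝔛.bdry (b k) * e := by
  rw [obj, fromLast_cone]
  simp [cone]

theorem hom_cone (e : D) (b : Fin (n + 1) → H) (i j : Fin (n + 1)) :
    (cone e b : 𝔛.Nerve n).hom i j = b i * (b j)⁻¹ := by
  simp [hom, fromLast_cone]

theorem map_cone (θ : Fin (m + 1) → Fin (n + 1)) (e : D) (b : Fin (n + 1) → H) :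
    map θ (cone e b : 𝔛.Nerve n) = cone e (b ∘ θ) :=
  ext_obj_hom (fun i => by simp only [obj_map, obj_cone, Function.comp])
    (fun i j => by simp only [hom_map, hom_cone, Function.comp])

/-- Every simplex is the face of a cone whose apex is its vertex `0`. -/
theorem eq_cone (g : 𝔛.Nerve n) : g = cone (g.obj 0) (fun k => g.hom k 0) :=
  ext_obj_hom (fun i => by rw [obj_cone, bdry_hom_mul_obj])
    (fun i j => by rw [hom_cone]; simp [hom])

/-- The apex of a cone can be moved. -/
theorem cone_eq_cone (e : D) (b : Fin (n + 1) → H) (u : H) :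
    (cone e b : 𝔛.Nerve n) = cone (𝔛.bdry u * e) (fun k => b k * u⁻¹) :=
  ext_obj_hom (fun i => by simp [obj_cone]) (fun i j => by simp [hom_cone])

theorem cone_mul (e e' : D) (b b' : Fin (n + 1) → H) :
    (cone e b * cone e' b' : 𝔛.Nerve n) = cone (e * e') (fun k => b k * 𝔛.act e (b' k)) :=
  ext_obj_hom (fun i => by simp [obj_mul, obj_cone, 𝔛.equivariant, mul_assoc])
    (fun i j => by simp [hom_mul, hom_cone, obj_cone, 𝔛.peiffer, mul_assoc])

theorem cone_one : (cone 1 (fun _ => 1) : 𝔛.Nerve n) = 1 :=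
  Prod.ext (by simp [cone]) (funext fun k => by simp [cone])

theorem cone_inv (e : D) (b : Fin (n + 1) → H) :
    (cone e b : 𝔛.Nerve n)⁻¹ = cone e⁻¹ (fun k => 𝔛.act e⁻¹ (b k)⁻¹) := by
  rw [inv_eq_iff_mul_eq_one, cone_mul, ← cone_one]
  simp

theorem jetEq_cone {e e' : M → D} {b b' : M → Fin (n + 1) → H} (he : JetEq I 𝓘(ℝ, ED) x e e')
    (hb : ∀ k, JetEq I 𝓘(ℝ, EH) x (fun y => b y k) (fun y => b' y k)) :
    JetEq I (modelN ED EH n) x (fun y => (cone (e y) (b y) : 𝔛.Nerve n))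
      (fun y => cone (e' y) (b' y)) :=
  jetEq_mk ((jetEq_bdry (hb _)).mul he) fun _ => (hb _).mul (hb _).inv

/-- The element of `Lie(N_n C)` with the vertices `α(Xₖ) + Y` and the edges `Xᵢ - Xⱼ`. -/
def dCone (𝔛 : CrossedModule ED EH D H) (Y : E →L[ℝ] ED) (X : Fin (n + 1) → E →L[ℝ] EH) :
    E →L[ℝ] ED × (Fin n → EH) :=
  (𝔛.dBdry.comp (X (Fin.last n)) + Y).prod
    (ContinuousLinearMap.pi fun k => X k.castSucc + -X (Fin.last n))

theorem hasDer_cone {e : M → D} {b : M → Fin (n + 1) → H} {Y : E →L[ℝ] ED}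
    {X : Fin (n + 1) → E →L[ℝ] EH} (he : HasDer I 𝓘(ℝ, ED) e x Y) (he1 : e x = 1)
    (hb : ∀ k, HasDer I 𝓘(ℝ, EH) (fun y => b y k) x (X k)) (hb1 : ∀ k, b x k = 1) :
    HasDer I (modelN ED EH n) (fun y => (cone (e y) (b y) : 𝔛.Nerve n)) x (dCone 𝔛 Y X) :=
  hasDer_mk ((𝔛.hasDer_bdry (hb _) (hb1 _)).mul_one_one he (by simp [hb1]) he1)
    fun k => (hb _).mul_one_one ((hb _).inv_one (hb1 _)) (hb1 _) (by simp [hb1])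

end CrossedModule.Nerve

end CrossedCalculus

/-! ### Connection forms on trivial principal bundles -/

section Trivial

variable {E : Type*} [NormedAddCommGroup E] [NormedSpace ℝ E]
  {B : Type*} [TopologicalSpace B] {I : ModelWithCorners ℝ E B}
  {U : Type*} [TopologicalSpace U] [ChartedSpace B U]
  {U₂ : Type*} [TopologicalSpace U₂] [ChartedSpace B U₂]
  {E₁ : Type*} [NormedAddCommGroup E₁] [NormedSpace ℝ E₁]
  {B₁ : Type*} [TopologicalSpace B₁] {I₁ : ModelWithCorners ℝ E₁ B₁}
  {G : Type*} [TopologicalSpace G] [ChartedSpace B₁ G] [Group G] [LieGroup I₁ ∞ G]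
  {E₂ : Type*} [NormedAddCommGroup E₂] [NormedSpace ℝ E₂]
  {B₂ : Type*} [TopologicalSpace B₂] {I₂ : ModelWithCorners ℝ E₂ B₂}
  {G₂ : Type*} [TopologicalSpace G₂] [ChartedSpace B₂ G₂] [Group G₂] [LieGroup I₂ ∞ G₂]

variable (I₁) in
/-- The value `g L g⁻¹ + g dg⁻¹` over the point `g` of the fibre of the connection form on the
trivial principal `G`-bundle whose local form is `L`. -/
def totalForm (g : G) (L : E →L[ℝ] E₁) : E₁ × E →L[ℝ] E₁ :=
  (dMulDInv I₁ I₁ (fun k : G => k) g).coprod ((dAd I₁ g).comp L)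

theorem totalForm_comp_inr (g : G) (L : E →L[ℝ] E₁) :
    (totalForm I₁ g L).comp (ContinuousLinearMap.inr ℝ E₁ E) = (dAd I₁ g).comp L := by
  ext v; simp [totalForm]

theorem totalForm_comp_inl (g : G) (L : E →L[ℝ] E₁) :
    (totalForm I₁ g L).comp (ContinuousLinearMap.inl ℝ E₁ E) =
      dMulDInv I₁ I₁ (fun k : G => k) g := by
  ext v; simp [totalForm]

theorem dAd_one : dAd I₁ (1 : G) = ContinuousLinearMap.id ℝ E₁ :=
  (hasDer_conj (I₁ := I₁) (1 : G)).eq (by simpa using HasDer.id (I := I₁) (1 : G))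

theorem dAd_mul (g k : G) : dAd I₁ (g * k) = (dAd I₁ g).comp (dAd I₁ k) := by
  refine (hasDer_conj (I₁ := I₁) (g * k)).eq ?_
  convert (hasDer_conj (I₁ := I₁) k).conj g (by simp) using 2
  group

/-- If `S` has the derivative `L`, then `totalForm g L` is the derivative of
`(k, y) ↦ g S(y) k⁻¹`. -/
theorem hasDer_totalForm {S : U → G} {u : U} {L : E →L[ℝ] E₁} (hS : HasDer I I₁ S u L)
    (hS1 : S u = 1) (g : G) :
    HasDer (I₁.prod I) I₁ (fun q : G × U => g * S q.2 * q.1⁻¹) (g, u) (totalForm I₁ g L) := by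
  have hc : MDifferentiableAt (I₁.prod I) I₁ (fun _ : G × U => g) (g, u) := mdifferentiableAt_const
  refine HasDer.of_partial ((hc.mul_group (hS.comp (HasDer.snd (I₁ := I₁) (g, u))
    rfl).mdifferentiableAt).mul_group (HasDer.fst (g, u)).mdifferentiableAt.inv_group) ?_ ?_
  · simpa [hS1] using hasDer_mul_inv_left (I₁ := I₁) g
  · exact hS.conj g hS1

section Map

variable {φ : G → G₂} {w : U → G₂} {ι : U → U₂} {u : U} {S : U → G} {S₂ : U₂ → G₂}
  {L : E →L[ℝ] E₁} {L₂ : E →L[ℝ] E₂}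

theorem hasDer_twisted (hφ : MDifferentiable I₁ I₂ φ) (hw : MDifferentiableAt I I₂ w u)
    (hι : MDifferentiableAt I I ι u) (g : G) :
    HasDer (I₁.prod I) (I₂.prod I) (fun q : G × U => (φ q.1 * w q.2, ι q.2)) (g, u)
      (der (I₁.prod I) (I₂.prod I) (fun q : G × U => (φ q.1 * w q.2, ι q.2)) (g, u)) := by
  have h₁ := (HasDer.fst (I₁ := I₁) (I₂ := I) (g, u)).mdifferentiableAt
  have h₂ := (HasDer.snd (I₁ := I₁) (I₂ := I) (g, u)).mdifferentiableAt
  exact hasDer_der ((((hφ g).comp (g, u) h₁).mul_group (hw.comp (g, u) h₂)).prodMk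
    (hι.comp (g, u) h₂))

/-- A twisted map of trivial principal bundles is compatible with connection forms if their local
forms are related by the gauge transformation `L ↦ w L w⁻¹ + w dw⁻¹`. -/
theorem totalForm_comp_of_jetEq (hφ : MDifferentiable I₁ I₂ φ)
    (hm : ∀ a b, φ (a * b) = φ a * φ b) (hw : MDifferentiableAt I I₂ w u)
    (hι : MDifferentiableAt I I ι u) (hS : HasDer I I₁ S u L) (hS1 : S u = 1)
    (hS₂ : HasDer I I₂ S₂ (ι u) L₂) (hS₂1 : S₂ (ι u) = 1)
    (h : JetEq I I₂ u (fun y => φ (S y)) (fun y => w u * S₂ (ι y) * (w y)⁻¹)) (g : G) :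
    (totalForm I₂ (φ g * w u) L₂).comp
        (der (I₁.prod I) (I₂.prod I) (fun q : G × U => (φ q.1 * w q.2, ι q.2)) (g, u)) =
      (dLie I₁ I₂ φ).comp (totalForm I₁ g L) := by
  have h₁ := (hasDer_totalForm hS hS1 g).lieMap (hφ 1) (by simp [hS1])
  have h₂ := (hasDer_totalForm hS₂ hS₂1 (φ g * w u)).comp (hasDer_twisted hφ hw hι g) rfl
  have hi : ∀ a, φ a⁻¹ = (φ a)⁻¹ := fun a => map_inv (MonoidHom.mk' φ hm) a
  have hc : MDifferentiableAt (I₁.prod I) I₂ (fun _ : G × U => φ g) (g, u) :=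
    mdifferentiableAt_const
  have hk : MDifferentiableAt (I₁.prod I) I₂ (fun q : G × U => φ q.1⁻¹) (g, u) :=
    (hφ _).comp (g, u) (HasDer.fst (g, u)).mdifferentiableAt.inv_group
  have e := ((JetEq.refl hc).mul (h.precomp (I₂ := I₁.prod I) (z := (g, u))
    (HasDer.snd (g, u)).mdifferentiableAt rfl)).mul (JetEq.refl hk)
  refine h₂.eq (e.symm.hasDer (L := (dLie I₁ I₂ φ).comp (totalForm I₁ g L)) ?_ |>.of_eventuallyEq
    (.of_forall fun q => ?_))
  · exact h₁.of_eventuallyEq (.of_forall fun q => by simp [hm])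
  · simp [hi, mul_assoc]

/-- The converse of `totalForm_comp_of_jetEq`; the compatibility over the unit of `G` suffices. -/
theorem jetEq_of_totalForm_comp (hφ : MDifferentiable I₁ I₂ φ)
    (hm : ∀ a b, φ (a * b) = φ a * φ b) (hw : MDifferentiableAt I I₂ w u)
    (hι : MDifferentiableAt I I ι u) (hS : HasDer I I₁ S u L) (hS1 : S u = 1)
    (hS₂ : HasDer I I₂ S₂ (ι u) L₂) (hS₂1 : S₂ (ι u) = 1)
    (h : (totalForm I₂ (φ 1 * w u) L₂).comp
        (der (I₁.prod I) (I₂.prod I) (fun q : G × U => (φ q.1 * w q.2, ι q.2)) (1, u)) =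
      (dLie I₁ I₂ φ).comp (totalForm I₁ (1 : G) L)) :
    JetEq I I₂ u (fun y => φ (S y)) (fun y => w u * S₂ (ι y) * (w y)⁻¹) := by
  have h1 : φ 1 = 1 := map_one (MonoidHom.mk' φ hm)
  have h₁ := (hasDer_totalForm hS hS1 (1 : G)).lieMap (hφ 1) (by simp [hS1])
  have h₂ := (hasDer_totalForm hS₂ hS₂1 (φ 1 * w u)).comp (hasDer_twisted hφ hw hι (1 : G)) rfl
  have e := JetEq.of_hasDer h₁ h₂ (by simp [hS1, hS₂1, h1]) h.symm
  have := e.precomp (I₂ := I) (φ := fun y : U => ((1 : G), y)) (z := u)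
    (mdifferentiableAt_const.prodMk mdifferentiableAt_id) rfl
  simpa [h1] using this

end Map

/-- The form `g L g⁻¹ + g dg⁻¹` is equivariant. -/
theorem totalForm_mul (g k : G) (L : E →L[ℝ] E₁) (u : U) :
    (totalForm I₁ (g * k) L).comp
        (der (I₁.prod I) (I₁.prod I) (fun q : G × U => (g * q.1, q.2)) (k, u)) =
      (dAd I₁ g).comp (totalForm I₁ k L) := by
  have hd : MDifferentiableAt I₁ I₁ (fun a : G => g * a) k :=
    mdifferentiableAt_const.mul_group mdifferentiableAt_id
  obtain ⟨Lg, hg⟩ := exists_hasDer hd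
  have h := (hg.comp (HasDer.fst (I₁ := I₁) (I₂ := I) (k, u)) rfl).prodMk
    (HasDer.snd (I₁ := I₁) (I₂ := I) (k, u))
  rw [h.der_eq]
  have e : (dMulDInv I₁ I₁ (fun a : G => a) (g * k)).comp Lg =
      (dAd I₁ g).comp (dMulDInv I₁ I₁ (fun a : G => a) k) := by
    refine ((hasDer_mul_inv_left (I₁ := I₁) (g * k)).comp hg rfl).eq ?_
    convert (hasDer_mul_inv_left (I₁ := I₁) k).conj g (by simp) using 2
    group
  ext v
  · simpa [totalForm] using DFunLike.congr_fun e v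
  · simp [totalForm, dAd_mul]

variable [IsManifold I ∞ U]

/-- An equivariant form which restricts to the Cartan-Maurer form on the fibres is determined by
its local form. -/
theorem OneForm.at_eq_totalForm (η : OneForm (I₁.prod I) (G × U) I₁ G)
    (he : ∀ g p, η.pullAt (I₁.prod I) (fun q : G × U => (g * q.1, q.2)) p =
      (dAd I₁ g).comp (η.at p))
    (hcm : ∀ u g, η.pullAt I₁ (fun k : G => (k, u)) g = dMulDInv I₁ I₁ (fun k : G => k) g)
    (g : G) (u : U) :
    η.at (g, u) = totalForm I₁ g ((η.at (1, u)).comp (ContinuousLinearMap.inr ℝ E₁ E)) := by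
  have h₁ := hcm u g
  rw [η.pullAt_eq ((HasDer.id (I := I₁) g).prodMk (HasDer.const (I₁ := I) u g))] at h₁
  have hd : MDifferentiableAt I₁ I₁ (fun a : G => g * a) 1 :=
    mdifferentiableAt_const.mul_group mdifferentiableAt_id
  obtain ⟨Lg, hg⟩ := exists_hasDer hd
  have h₂ := he g (1, u)
  rw [η.pullAt_eq ((hg.comp (HasDer.fst (I₁ := I₁) (I₂ := I) (1, u)) rfl).prodMk
    (HasDer.snd (I₁ := I₁) (I₂ := I) (1, u)))] at h₂
  simp only [mul_one] at h₂
  ext v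
  · simpa [totalForm] using DFunLike.congr_fun h₁ v
  · simpa [totalForm] using DFunLike.congr_fun h₂ (0, v)

/-- The connection form with a smooth local form is smooth. -/
theorem contMDiff_totalForm {L : U → E →L[ℝ] E₁}
    (hL : ContMDiff (M := TangentBundle I U) I.tangent 𝓘(ℝ, E₁) ∞ (fun v => L v.1 v.2)) :
    ContMDiff (M := TangentBundle (I₁.prod I) (G × U)) (I₁.prod I).tangent 𝓘(ℝ, E₁) ∞
      (fun v => totalForm I₁ v.1.1 (L v.1.2) v.2) := by
  have : IsManifold I₁ 1 G := isManifold_one I₁ G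
  have : IsManifold I 1 U := isManifold_one I U
  have he := contMDiff_equivTangentBundleProd (n := ∞) (I := I₁) (M := G) (I' := I) (M' := U)
  have h₁ := (contMDiff_mulDInv (I₁ := I₁) (G := G)).comp (contMDiff_fst.comp he)
  have h₂ := (contMDiff_Ad (I₁ := I₁) (G := G)).comp
    (((Bundle.contMDiff_proj (TangentSpace I₁)).comp (contMDiff_fst.comp he)).prodMk
      (hL.comp (contMDiff_snd.comp he)))
  exact h₁.add h₂

end Trivial

/-! ### Vertices and edges in the Lie algebras of the nerve -/

section LieNerve

theorem dLie_comp {E₁ E₂ E₃ B₁ B₂ B₃ G₁ G₂ G₃ : Type*}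
    [NormedAddCommGroup E₁] [NormedSpace ℝ E₁] [NormedAddCommGroup E₂] [NormedSpace ℝ E₂]
    [NormedAddCommGroup E₃] [NormedSpace ℝ E₃] [TopologicalSpace B₁] [TopologicalSpace B₂]
    [TopologicalSpace B₃] {I₁ : ModelWithCorners ℝ E₁ B₁} {I₂ : ModelWithCorners ℝ E₂ B₂}
    {I₃ : ModelWithCorners ℝ E₃ B₃} [TopologicalSpace G₁] [ChartedSpace B₁ G₁] [Group G₁]
    [TopologicalSpace G₂] [ChartedSpace B₂ G₂] [Group G₂]
    [TopologicalSpace G₃] [ChartedSpace B₃ G₃] [Group G₃] {f : G₁ → G₂} {g : G₂ → G₃}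
    (hf : MDifferentiable I₁ I₂ f) (hg : MDifferentiable I₂ I₃ g) (h1 : f 1 = 1) :
    (dLie I₂ I₃ g).comp (dLie I₁ I₂ f) = dLie I₁ I₃ (fun x => g (f x)) :=
  ((hasDer_der (hg 1)).comp (hasDer_der (hf 1)) h1).eq (hasDer_der ((hg _).comp _ (hf 1)))

variable {ED EH D H : Type*}
  [NormedAddCommGroup ED] [NormedSpace ℝ ED] [NormedAddCommGroup EH] [NormedSpace ℝ EH]
  [TopologicalSpace D] [ChartedSpace ED D] [Group D] [LieGroup 𝓘(ℝ, ED) ∞ D]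
  [TopologicalSpace H] [ChartedSpace EH H] [Group H] [LieGroup 𝓘(ℝ, EH) ∞ H]

namespace CrossedModule

variable (𝔛 : CrossedModule ED EH D H) {n m : ℕ}

/-- The `k`-th vertex of an element of `Lie(N_n C)`. -/
def objLie (k : Fin (n + 1)) : ED × (Fin n → EH) →L[ℝ] ED :=
  dLie (modelN ED EH n) 𝓘(ℝ, ED) (fun g : 𝔛.Nerve n => g.obj k)

/-- The edge from the vertex `j` to the vertex `i` of an element of `Lie(N_n C)`. -/
def homLie (i j : Fin (n + 1)) : ED × (Fin n → EH) →L[ℝ] EH :=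
  dLie (modelN ED EH n) 𝓘(ℝ, EH) (fun g : 𝔛.Nerve n => g.hom i j)

/-- The reindexing of elements of `Lie(N_n C)`. -/
def mapLie (θ : Fin (m + 1) → Fin (n + 1)) : ED × (Fin n → EH) →L[ℝ] ED × (Fin m → EH) :=
  dLie (modelN ED EH n) (modelN ED EH m) (Nerve.map (𝔛 := 𝔛) θ)

variable {𝔛}

theorem Nerve.obj_one (k : Fin (n + 1)) : (1 : 𝔛.Nerve n).obj k = 1 := by
  simp [← Nerve.cone_one, Nerve.obj_cone]

theorem Nerve.hom_one (i j : Fin (n + 1)) : (1 : 𝔛.Nerve n).hom i j = 1 := by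
  simp [← Nerve.cone_one, Nerve.hom_cone]

theorem Nerve.map_one (θ : Fin (m + 1) → Fin (n + 1)) : Nerve.map θ (1 : 𝔛.Nerve n) = 1 := by
  rw [← Nerve.cone_one, Nerve.map_cone, ← Nerve.cone_one]
  rfl

theorem objLie_comp_mapLie (θ : Fin (m + 1) → Fin (n + 1)) (k : Fin (m + 1)) :
    (𝔛.objLie k).comp (𝔛.mapLie θ) = 𝔛.objLie (θ k) := by
  rw [objLie, mapLie, dLie_comp (Nerve.mdifferentiable_map θ) (Nerve.mdifferentiable_obj k)
    (Nerve.map_one θ)]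
  simp only [Nerve.obj_map]
  rfl

theorem homLie_comp_mapLie (θ : Fin (m + 1) → Fin (n + 1)) (i j : Fin (m + 1)) :
    (𝔛.homLie i j).comp (𝔛.mapLie θ) = 𝔛.homLie (θ i) (θ j) := by
  rw [homLie, mapLie, dLie_comp (Nerve.mdifferentiable_map θ) (Nerve.mdifferentiable_hom i j)
    (Nerve.map_one θ)]
  simp only [Nerve.hom_map]
  rfl

theorem hasDer_homLie (i j : Fin (n + 1)) : HasDer (modelN ED EH n) 𝓘(ℝ, EH)
    (fun g : 𝔛.Nerve n => g.hom i j) 1 (𝔛.homLie i j) :=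
  hasDer_der (Nerve.mdifferentiable_hom i j 1)

theorem homLie_self (i : Fin (n + 1)) : 𝔛.homLie i i = 0 :=
  (hasDer_homLie (𝔛 := 𝔛) i i).eq (by
    simpa [Nerve.hom] using
      HasDer.const (I := modelN ED EH n) (I₁ := 𝓘(ℝ, EH)) (1 : H) (1 : 𝔛.Nerve n))

theorem homLie_symm (i j : Fin (n + 1)) : 𝔛.homLie i j = -𝔛.homLie j i :=
  (hasDer_homLie (𝔛 := 𝔛) i j).eq (by
    simpa [Nerve.hom] using (hasDer_homLie (𝔛 := 𝔛) j i).inv_one (Nerve.hom_one j i))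

/-- An element of `Lie(N_n C)` is determined by its leading vertex and the edges that start
there. -/
theorem eq_dCone {E : Type*} [NormedAddCommGroup E] [NormedSpace ℝ E]
    (L : E →L[ℝ] ED × (Fin n → EH)) :
    L = Nerve.dCone 𝔛 ((𝔛.objLie 0).comp L) (fun k => (𝔛.homLie k 0).comp L) := by
  have : IsManifold (modelN ED EH n) 1 (𝔛.Nerve n) := isManifold_one _ _
  obtain ⟨S, hS1, hS⟩ :=
    exists_hasDer_eq (I := 𝓘(ℝ, E)) (I₁ := modelN ED EH n) (0 : E) (1 : 𝔛.Nerve n) L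
  refine hS.eq ?_
  have h := Nerve.hasDer_cone (𝔛 := 𝔛) (hS.lieMap (Nerve.mdifferentiable_obj 0 1) hS1)
    (by simp [hS1, Nerve.obj_one])
    (b := fun y k => (S y).hom k 0)
    (fun k => hS.lieMap (Nerve.mdifferentiable_hom k 0 1) hS1) (by simp [hS1, Nerve.hom_one])
  simp only [← Nerve.eq_cone] at h
  exact h

section Cone

variable {E : Type*} [NormedAddCommGroup E] [NormedSpace ℝ E] (Y : E →L[ℝ] ED)
  (Z : Fin (n + 1) → E →L[ℝ] EH)

/-- The element `dCone 𝔛 Y Z` is the derivative of a family of cones. -/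
theorem exists_hasDer_cone : ∃ (e : E → D) (b : E → Fin (n + 1) → H), e 0 = 1 ∧
    HasDer 𝓘(ℝ, E) 𝓘(ℝ, ED) e 0 Y ∧ (∀ k, b 0 k = 1) ∧
    (∀ k, HasDer 𝓘(ℝ, E) 𝓘(ℝ, EH) (fun y => b y k) 0 (Z k)) ∧
    HasDer 𝓘(ℝ, E) (modelN ED EH n) (fun y => (Nerve.cone (e y) (b y) : 𝔛.Nerve n)) 0
      (Nerve.dCone 𝔛 Y Z) ∧ (Nerve.cone (e 0) (b 0) : 𝔛.Nerve n) = 1 := by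
  have : IsManifold 𝓘(ℝ, ED) 1 D := isManifold_one _ _
  have : IsManifold 𝓘(ℝ, EH) 1 H := isManifold_one _ _
  obtain ⟨e, he1, he⟩ := exists_hasDer_eq (I := 𝓘(ℝ, E)) (I₁ := 𝓘(ℝ, ED)) (0 : E) (1 : D) Y
  choose b hb1 hb using fun k =>
    exists_hasDer_eq (I := 𝓘(ℝ, E)) (I₁ := 𝓘(ℝ, EH)) (0 : E) (1 : H) (Z k)
  exact ⟨e, fun y k => b k y, he1, he, hb1, hb, Nerve.hasDer_cone he he1 hb hb1,
    by simp [he1, hb1, Nerve.cone_one]⟩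

theorem mapLie_comp_dCone (θ : Fin (m + 1) → Fin (n + 1)) :
    (𝔛.mapLie θ).comp (Nerve.dCone 𝔛 Y Z) = Nerve.dCone 𝔛 Y (Z ∘ θ) := by
  obtain ⟨e, b, he1, he, hb1, hb, h, h1⟩ := exists_hasDer_cone (𝔛 := 𝔛) Y Z
  refine (h.lieMap (Nerve.mdifferentiable_map θ 1) h1).eq ?_
  simp only [Nerve.map_cone]
  exact Nerve.hasDer_cone he he1 (fun k => hb (θ k)) fun k => hb1 (θ k)

theorem objLie_comp_dCone (k : Fin (n + 1)) :
    (𝔛.objLie k).comp (Nerve.dCone 𝔛 Y Z) = 𝔛.dBdry.comp (Z k) + Y := by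
  obtain ⟨e, b, he1, he, hb1, hb, h, h1⟩ := exists_hasDer_cone (𝔛 := 𝔛) Y Z
  refine (h.lieMap (Nerve.mdifferentiable_obj k 1) h1).eq ?_
  simp only [Nerve.obj_cone]
  exact (𝔛.hasDer_bdry (hb k) (hb1 k)).mul_one_one he (by simp [hb1]) he1

theorem homLie_comp_dCone (i j : Fin (n + 1)) :
    (𝔛.homLie i j).comp (Nerve.dCone 𝔛 Y Z) = Z i + -Z j := by
  obtain ⟨e, b, he1, he, hb1, hb, h, h1⟩ := exists_hasDer_cone (𝔛 := 𝔛) Y Z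
  refine (h.lieMap (Nerve.mdifferentiable_hom i j 1) h1).eq ?_
  simp only [Nerve.hom_cone]
  exact (hb i).mul_one_one ((hb j).inv_one (hb1 j)) (hb1 i) (by simp [hb1])

end Cone

end CrossedModule

end LieNerve

theorem JetEq.of_val {E E₁ B B₁ M K : Type*} [NormedAddCommGroup E] [NormedSpace ℝ E]
    [NormedAddCommGroup E₁] [NormedSpace ℝ E₁] [TopologicalSpace B] [TopologicalSpace B₁]
    {I : ModelWithCorners ℝ E B} {I₁ : ModelWithCorners ℝ E₁ B₁}
    [TopologicalSpace M] [ChartedSpace B M] [TopologicalSpace K] [ChartedSpace B₁ K]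
    {U : Opens M} {x : U} {f g : M → K}
    (h : JetEq I I₁ x (fun y : U => f y) (fun y : U => g y)) (hf : MDifferentiableAt I I₁ f x)
    (hg : MDifferentiableAt I I₁ g x) : JetEq I I₁ (x : M) f g := by
  obtain ⟨L, hf⟩ := exists_hasDer hf
  obtain ⟨L', hg⟩ := exists_hasDer hg
  obtain ⟨e, L₀, hf₀, hg₀⟩ := h
  refine .of_hasDer hf hg e ?_
  have e₁ := (hf.comp (hasDer_val x) rfl).eq hf₀
  have e₂ := (hg.comp (hasDer_val x) rfl).eq hg₀
  rw [← e₂] at e₁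
  simpa using e₁

theorem HasDer.val {E E₁ B B₁ M K : Type*} [NormedAddCommGroup E] [NormedSpace ℝ E]
    [NormedAddCommGroup E₁] [NormedSpace ℝ E₁] [TopologicalSpace B] [TopologicalSpace B₁]
    {I : ModelWithCorners ℝ E B} {I₁ : ModelWithCorners ℝ E₁ B₁}
    [TopologicalSpace M] [ChartedSpace B M] [TopologicalSpace K] [ChartedSpace B₁ K]
    {U : Opens M} {x : U} {f : M → K} {L : E →L[ℝ] E₁} (h : HasDer I I₁ f (x : M) L) :
    HasDer I I₁ (fun y : U => f y) x L := by
  simpa using h.comp (hasDer_val x) rfl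

/-! ### The local forms of a simplicial connection -/

section Gerbe

open CrossedModule

variable {ED EH D H : Type*}
  [NormedAddCommGroup ED] [NormedSpace ℝ ED] [NormedAddCommGroup EH] [NormedSpace ℝ EH]
  [TopologicalSpace D] [ChartedSpace ED D] [Group D] [LieGroup 𝓘(ℝ, ED) ∞ D]
  [TopologicalSpace H] [ChartedSpace EH H] [Group H] [LieGroup 𝓘(ℝ, EH) ∞ H]
  {E X : Type*} [NormedAddCommGroup E] [NormedSpace ℝ E]
  [TopologicalSpace X] [ChartedSpace E X] [IsManifold 𝓘(ℝ, E) ∞ X]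
  {ι : Type*} {𝔛 : CrossedModule ED EH D H} {O : ι → Opens X}

theorem hasDer_overlapMap {n m : ℕ} (a : Fin (n + 1) → ι) (θ : Fin (m + 1) → Fin (n + 1))
    (x : overlap O a) :
    HasDer 𝓘(ℝ, E) 𝓘(ℝ, E) (overlapMap O a θ) x (ContinuousLinearMap.id ℝ E) :=
  HasDer.codRestrict (hasDer_val x)

namespace Cocycle

variable (c : Cocycle E 𝔛 O)

theorem mdifferentiableAt_d {α β : ι} {x : X} (hα : x ∈ O α) (hβ : x ∈ O β) :
    MDifferentiableAt 𝓘(ℝ, E) 𝓘(ℝ, ED) (c.d α β) x :=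
  ((c.smooth_d α β).contMDiffAt ((O α ⊓ O β).isOpen.mem_nhds ⟨hα, hβ⟩)).mdifferentiableAt (by simp)

theorem mdifferentiableAt_h {α β γ : ι} {x : X} (hα : x ∈ O α) (hβ : x ∈ O β) (hγ : x ∈ O γ) :
    MDifferentiableAt 𝓘(ℝ, E) 𝓘(ℝ, EH) (c.h α β γ) x :=
  ((c.smooth_h α β γ).contMDiffAt
    ((O α ⊓ O β ⊓ O γ).isOpen.mem_nhds ⟨⟨hα, hβ⟩, hγ⟩)).mdifferentiableAt (by simp)

/-- The twisting function is the cone with the apex `d_{α₀α₁}` and the edges `h_{α₀α₁αₖ₊₁}⁻¹`. -/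
theorem twist_eq_cone {n : ℕ} {a : Fin (n + 2) → ι} {x : X} (hx : x ∈ overlap O a) :
    c.twist a x = Nerve.cone (c.d (a 0) (a 1) x) (fun k => (c.h (a 0) (a 1) (a k.succ) x)⁻¹) := by
  have hx' := mem_overlap.1 hx
  refine Nerve.ext_obj_hom (fun k => ?_) (fun i j => ?_)
  · rw [c.obj_twist hx, Nerve.obj_cone, map_inv, eq_inv_mul_iff_mul_eq, ← mul_assoc,
      ← c.cocycle_d _ _ _ x ⟨⟨hx' _, hx' _⟩, hx' _⟩, mul_inv_cancel_right]
  · rw [hom_twist, Nerve.hom_cone, inv_inv]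

theorem jetEq_twist {n : ℕ} {a : Fin (n + 2) → ι} {x : X} (hx : x ∈ overlap O a) :
    JetEq 𝓘(ℝ, E) (modelN ED EH n) x (c.twist a) (fun y =>
      Nerve.cone (c.d (a 0) (a 1) y) (fun k => (c.h (a 0) (a 1) (a k.succ) y)⁻¹)) := by
  have hx' := mem_overlap.1 hx
  refine .of_eventuallyEq (Nerve.jetEq_cone (.refl (c.mdifferentiableAt_d (hx' _) (hx' _)))
    fun k => (JetEq.refl (c.mdifferentiableAt_h (hx' _) (hx' _) (hx' _))).inv).left ?_
  filter_upwards [(overlap O a).isOpen.mem_nhds hx] with y hy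
  exact c.twist_eq_cone hy

/-- The factor `w` in `∂ᵢ(g, x) = (∂ᵢg · w(x), ∂ᵢx)`. -/
def faceFactor {n : ℕ} (a : Fin (n + 2) → ι) (i : Fin (n + 2)) (x : X) : 𝔛.Nerve n :=
  if i = 0 then c.twist a x else 1

theorem totalFace_eq {n : ℕ} (a : Fin (n + 2) → ι) (i : Fin (n + 2)) :
    c.totalFace a i = fun p : c.Total a =>
      (p.1.face i * c.faceFactor a i p.2, overlapMap O a i.succAbove p.2) := by
  funext p
  by_cases hi : i = 0
  · subst hi
    simp [totalFace, faceFactor]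
  · simp [totalFace, faceFactor, hi]

theorem totalDegen_eq {n : ℕ} (a : Fin (n + 1) → ι) (i : Fin (n + 1)) :
    c.totalDegen a i = fun p : c.Total a => (p.1.degen i * 1, overlapMap O a i.predAbove p.2) := by
  funext p
  simp [totalDegen]

theorem mdifferentiableAt_faceFactor {n : ℕ} (a : Fin (n + 2) → ι) (i : Fin (n + 2)) {x : X}
    (hx : x ∈ overlap O a) : MDifferentiableAt 𝓘(ℝ, E) (modelN ED EH n) (c.faceFactor a i) x := by
  unfold faceFactor
  split_ifs
  · exact (c.jetEq_twist hx).left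
  · exact mdifferentiableAt_const

end Cocycle

variable {c : Cocycle E 𝔛 O}

namespace SimplicialConnection

variable (𝒜 : SimplicialConnection c) {n : ℕ}

/-- The local form `σ^* 𝒜` on the component `a`. -/
def loc (a : Fin (n + 1) → ι) (x : overlap O a) : E →L[ℝ] ED × (Fin n → EH) :=
  ((𝒜.form a).at (1, x)).comp (ContinuousLinearMap.inr ℝ _ E)

/-- A simplicial connection is determined by its local forms. -/
theorem form_at (a : Fin (n + 1) → ι) (g : 𝔛.Nerve n) (x : overlap O a) :
    (𝒜.form a).at (g, x) = totalForm (modelN ED EH n) g (𝒜.loc a x) :=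
  OneForm.at_eq_totalForm _ (𝒜.equivariant a) (𝒜.cartanMaurer a) g x

theorem jetEq_face (a : Fin (n + 2) → ι) (i : Fin (n + 2)) (x : overlap O a)
    {S : X → 𝔛.Nerve (n + 1)} {S' : X → 𝔛.Nerve n}
    (hS : HasDer 𝓘(ℝ, E) (modelN ED EH (n + 1)) S (x : X) (𝒜.loc a x)) (hS1 : S x = 1)
    (hS' : HasDer 𝓘(ℝ, E) (modelN ED EH n) S' (x : X)
      (𝒜.loc (a ∘ i.succAbove) (overlapMap O a i.succAbove x))) (hS'1 : S' x = 1) :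
    JetEq 𝓘(ℝ, E) (modelN ED EH n) (x : X) (fun y => (S y).face i)
      (fun y => c.faceFactor a i x * S' y * (c.faceFactor a i y)⁻¹) := by
  have hw := c.mdifferentiableAt_faceFactor a i x.2
  have hφ := Nerve.mdifferentiable_map (𝔛 := 𝔛) i.succAbove
  have hι := (hasDer_overlapMap (E := E) (O := O) a i.succAbove x).mdifferentiableAt
  refine .of_val (jetEq_of_totalForm_comp (φ := Nerve.face i) (ι := overlapMap O a i.succAbove)
    (w := fun y : overlap O a => c.faceFactor a i y) (S₂ := fun y => S' y) hφ
    (Nerve.map_mul _) (hasDer_der hw).val.mdifferentiableAt hι hS.val hS1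
    (HasDer.val (x := overlapMap O a i.succAbove x) hS') hS'1 ?_)
    ((hφ _).comp _ hS.mdifferentiableAt)
    ((mdifferentiableAt_const.mul_group hS'.mdifferentiableAt).mul_group hw.inv_group)
  have h := 𝒜.face a i (1, x)
  rw [← 𝒜.form_at a 1 x, ← 𝒜.form_at (a ∘ i.succAbove) _ (overlapMap O a i.succAbove x)]
  rw [c.totalFace_eq] at h
  exact h

theorem jetEq_degen (a : Fin (n + 1) → ι) (i : Fin (n + 1)) (x : overlap O a)
    {S : X → 𝔛.Nerve n} {S' : X → 𝔛.Nerve (n + 1)}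
    (hS : HasDer 𝓘(ℝ, E) (modelN ED EH n) S (x : X) (𝒜.loc a x)) (hS1 : S x = 1)
    (hS' : HasDer 𝓘(ℝ, E) (modelN ED EH (n + 1)) S' (x : X)
      (𝒜.loc (a ∘ i.predAbove) (overlapMap O a i.predAbove x))) (hS'1 : S' x = 1) :
    JetEq 𝓘(ℝ, E) (modelN ED EH (n + 1)) (x : X) (fun y => (S y).degen i) S' := by
  have hφ := Nerve.mdifferentiable_map (𝔛 := 𝔛) i.predAbove
  have hι := (hasDer_overlapMap (E := E) (O := O) a i.predAbove x).mdifferentiableAt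
  have := jetEq_of_totalForm_comp (φ := Nerve.degen i) (ι := overlapMap O a i.predAbove)
    (w := fun y : overlap O a => (1 : 𝔛.Nerve (n + 1))) (S₂ := fun y => S' y) hφ
    (Nerve.map_mul _) mdifferentiableAt_const hι hS.val hS1
    (HasDer.val (x := overlapMap O a i.predAbove x) hS') hS'1 (by
      have h := 𝒜.degen a i (1, x)
      rw [← 𝒜.form_at a 1 x, ← 𝒜.form_at (a ∘ i.predAbove) _ (overlapMap O a i.predAbove x)]
      rw [c.totalDegen_eq] at h
      exact h)
  simp only [one_mul, inv_one, mul_one] at this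
  exact .of_val this ((hφ _).comp _ hS.mdifferentiableAt) hS'.mdifferentiableAt

/-- There is a map with the value `1` whose derivative is the local form. -/
theorem exists_hasDer_loc (a : Fin (n + 1) → ι) (x : overlap O a) :
    ∃ S : X → 𝔛.Nerve n, S x = 1 ∧
      HasDer 𝓘(ℝ, E) (modelN ED EH n) S (x : X) (𝒜.loc a x) := by
  have : IsManifold (modelN ED EH n) 1 (𝔛.Nerve n) := isManifold_one _ _
  have : IsManifold 𝓘(ℝ, E) 1 X := isManifold_one _ _
  exact exists_hasDer_eq _ _ _

theorem mapLie_face_loc (a : Fin (n + 2) → ι) {i : Fin (n + 2)} (hi : i ≠ 0) (x : overlap O a) :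
    (𝔛.mapLie i.succAbove).comp (𝒜.loc a x) =
      𝒜.loc (a ∘ i.succAbove) (overlapMap O a i.succAbove x) := by
  obtain ⟨S, hS1, hS⟩ := 𝒜.exists_hasDer_loc a x
  obtain ⟨S', hS'1, hS'⟩ :=
    𝒜.exists_hasDer_loc (a ∘ i.succAbove) (overlapMap O a i.succAbove x)
  have h := 𝒜.jetEq_face a i x hS hS1 hS' hS'1
  simp only [Cocycle.faceFactor, hi, if_false, one_mul, inv_one, mul_one] at h
  exact (hS.lieMap (Nerve.mdifferentiable_map _ _) hS1).eq (h.hasDer hS')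

theorem mapLie_degen_loc (a : Fin (n + 1) → ι) (i : Fin (n + 1)) (x : overlap O a) :
    (𝔛.mapLie i.predAbove).comp (𝒜.loc a x) =
      𝒜.loc (a ∘ i.predAbove) (overlapMap O a i.predAbove x) := by
  obtain ⟨S, hS1, hS⟩ := 𝒜.exists_hasDer_loc a x
  obtain ⟨S', hS'1, hS'⟩ :=
    𝒜.exists_hasDer_loc (a ∘ i.predAbove) (overlapMap O a i.predAbove x)
  exact (hS.lieMap (Nerve.mdifferentiable_map _ _) hS1).eq
    ((𝒜.jetEq_degen a i x hS hS1 hS' hS'1).hasDer hS')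

/-- The leading vertex of a local form depends only on the leading index: the faces `∂_i` with
`i > 0` preserve it. -/
theorem objLie_loc (a : Fin (n + 1) → ι) (x : overlap O a) {α : ι} (hα : a 0 = α)
    (x' : overlap O ![α]) (hx : (x : X) = x') :
    (𝔛.objLie 0).comp (𝒜.loc a x) = (𝔛.objLie 0).comp (𝒜.loc ![α] x') := by
  induction n with
  | zero =>
    obtain rfl : a = ![α] := funext fun i => by rw [Fin.fin_one_eq_zero i]; exact hα
    obtain rfl : x = x' := Subtype.ext hx
    rfl
  | succ n ih =>
    rw [← ih (a ∘ (Fin.last (n + 1)).succAbove) (overlapMap O a _ x) (by simpa using hα) hx,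
      ← 𝒜.mapLie_face_loc a (Fin.last_pos.ne') x, ← ContinuousLinearMap.comp_assoc,
      objLie_comp_mapLie]
    simp

/-- The local form over `(α, α)` is degenerate. -/
theorem homLie_loc_self (α : ι) (x : overlap O ![α, α]) :
    (𝔛.homLie 1 0).comp (𝒜.loc ![α, α] x) = 0 := by
  have hx := Cocycle.mem_overlap.1 x.2
  have h := 𝒜.mapLie_degen_loc ![α] 0 ⟨x, Cocycle.mem_overlap.2 fun i => by
    rw [Fin.fin_one_eq_zero i]; exact hx 0⟩
  have h' := congrArg (fun L => (𝔛.homLie 1 0).comp L) h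
  simp only [← ContinuousLinearMap.comp_assoc, homLie_comp_mapLie] at h'
  rw [show (Fin.predAbove 0 1 : Fin 1) = Fin.predAbove 0 0 from rfl, homLie_self,
    ContinuousLinearMap.zero_comp] at h'
  have key : ∀ (a : Fin 2 → ι) (y : overlap O a), a = ![α, α] → (y : X) = x →
      𝒜.loc ![α, α] x = (𝒜.loc a y : E →L[ℝ] ED × (Fin 1 → EH)) := by
    rintro a y rfl hy
    rw [Subtype.ext hy]
  rw [h']
  exact congrArg (fun L => (𝔛.homLie 1 0).comp L)
    (key _ _ (funext (Fin.forall_fin_two.2 ⟨rfl, rfl⟩)) rfl)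

/-- The edge from the vertex `0` to the vertex `k` of a local form depends only on the indices `a 0`
and `a k`: the faces that omit other vertices preserve it. -/
theorem homLie_loc (a : Fin (n + 1) → ι) (x : overlap O a) (k : Fin (n + 1)) {α β : ι}
    (hα : a 0 = α) (hβ : a k = β) (x' : overlap O ![α, β]) (hx : (x : X) = x') :
    (𝔛.homLie k 0).comp (𝒜.loc a x) = (𝔛.homLie 1 0).comp (𝒜.loc ![α, β] x') := by
  by_cases hk : k = 0
  · subst hk
    obtain rfl := hα.symm.trans hβ
    rw [homLie_self, homLie_loc_self, ContinuousLinearMap.zero_comp]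
  induction n with
  | zero => exact (hk (Fin.fin_one_eq_zero k)).elim
  | succ n ih =>
    cases n with
    | zero =>
      obtain rfl : k = 1 := Fin.eq_one_of_ne_zero k hk
      obtain rfl : a = ![α, β] := funext (Fin.forall_fin_two.2 ⟨hα, hβ⟩)
      obtain rfl : x = x' := Subtype.ext hx
      rfl
    | succ n =>
      -- Omit a vertex other than `0` and `k`.
      have key : ∀ (i : Fin (n + 3)) (j : Fin (n + 2)), i ≠ 0 → i.succAbove 0 = 0 →
          i.succAbove j = k → (𝔛.homLie k 0).comp (𝒜.loc a x) =
            (𝔛.homLie 1 0).comp (𝒜.loc ![α, β] x') := by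
        rintro i j hi h0 rfl
        rw [← ih (a ∘ i.succAbove) (overlapMap O a _ x) j (by simpa [h0] using hα) hβ hx
          (by rintro rfl; exact hk h0), ← 𝒜.mapLie_face_loc a hi x,
          ← ContinuousLinearMap.comp_assoc, homLie_comp_mapLie, h0]
      induction k using Fin.lastCases with
      | last =>
        refine key 1 (Fin.last _) (by simp) (by simp) ?_
        rw [← Fin.succ_zero_eq_one, ← Fin.succ_last]
        rw [Fin.succ_succAbove_succ]
        simp
      | cast k => exact key (Fin.last _) k Fin.last_pos.ne' (by simp) (by simp)

/-- The local forms of a simplicial connection are determined by those over the vertices and the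
edges of the Čech nerve. -/
theorem loc_eq (a : Fin (n + 1) → ι) (x : overlap O a) {Y : E →L[ℝ] ED}
    {Z : Fin (n + 1) → E →L[ℝ] EH}
    (hY : ∀ x' : overlap O ![a 0], (x : X) = x' → (𝔛.objLie 0).comp (𝒜.loc ![a 0] x') = Y)
    (hZ : ∀ k, ∀ x' : overlap O ![a 0, a k], (x : X) = x' →
      (𝔛.homLie 1 0).comp (𝒜.loc ![a 0, a k] x') = Z k) :
    𝒜.loc a x = Nerve.dCone 𝔛 Y Z := by
  have hx := Cocycle.mem_overlap.1 x.2
  have e₁ := 𝒜.objLie_loc a x rfl ⟨x, Cocycle.mem_overlap.2 fun i => by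
    rw [Fin.fin_one_eq_zero i]; exact hx 0⟩ rfl
  have e₂ := fun k => 𝒜.homLie_loc a x k rfl rfl ⟨x, Cocycle.mem_overlap.2
    (Fin.forall_fin_two.2 ⟨hx 0, hx k⟩)⟩ rfl
  rw [eq_dCone (𝔛 := 𝔛) (𝒜.loc a x), e₁, hY _ rfl]
  simp_rw [e₂, fun k => hZ k ⟨x, Cocycle.mem_overlap.2
    (Fin.forall_fin_two.2 ⟨hx 0, hx k⟩)⟩ rfl]

end SimplicialConnection

end Gerbe

/-! ### The gauge transformation by the twisting function -/

theorem jetEq_iff_of_hasDer {E E₁ B B₁ M K : Type*} [NormedAddCommGroup E] [NormedSpace ℝ E]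
    [NormedAddCommGroup E₁] [NormedSpace ℝ E₁] [TopologicalSpace B] [TopologicalSpace B₁]
    {I : ModelWithCorners ℝ E B} {I₁ : ModelWithCorners ℝ E₁ B₁}
    [TopologicalSpace M] [ChartedSpace B M] [TopologicalSpace K] [ChartedSpace B₁ K]
    {x : M} {f g : M → K} {L L' : E →L[ℝ] E₁} (hf : HasDer I I₁ f x L)
    (hg : HasDer I I₁ g x L') (e : f x = g x) : JetEq I I₁ x f g ↔ L = L' :=
  ⟨fun h => hf.eq (h.hasDer hg), .of_hasDer hf hg e⟩

theorem jetEq_congr {E E₁ B B₁ M K : Type*} [NormedAddCommGroup E] [NormedSpace ℝ E]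
    [NormedAddCommGroup E₁] [NormedSpace ℝ E₁] [TopologicalSpace B] [TopologicalSpace B₁]
    {I : ModelWithCorners ℝ E B} {I₁ : ModelWithCorners ℝ E₁ B₁}
    [TopologicalSpace M] [ChartedSpace B M] [TopologicalSpace K] [ChartedSpace B₁ K]
    {x : M} {f f' g g' : M → K} (hf : JetEq I I₁ x f f') (hg : JetEq I I₁ x g g') :
    JetEq I I₁ x f g ↔ JetEq I I₁ x f' g' :=
  ⟨fun h => hf.symm.trans (h.trans hg), fun h => hf.trans (h.trans hg.symm)⟩

section Gerbe

open CrossedModule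

variable {ED EH D H : Type*}
  [NormedAddCommGroup ED] [NormedSpace ℝ ED] [NormedAddCommGroup EH] [NormedSpace ℝ EH]
  [TopologicalSpace D] [ChartedSpace ED D] [Group D] [LieGroup 𝓘(ℝ, ED) ∞ D]
  [TopologicalSpace H] [ChartedSpace EH H] [Group H] [LieGroup 𝓘(ℝ, EH) ∞ H]
  {E X : Type*} [NormedAddCommGroup E] [NormedSpace ℝ E]
  [TopologicalSpace X] [ChartedSpace E X] [IsManifold 𝓘(ℝ, E) ∞ X]
  {ι : Type*} {𝔛 : CrossedModule ED EH D H} {O : ι → Opens X}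

/-- Two cones whose leading edges are trivial to first order have the same one-jet if and only if
their apices and edges have. -/
theorem CrossedModule.Nerve.jetEq_cone_iff {n : ℕ} {x : X} {e e' : X → D}
    {b b' : X → Fin (n + 1) → H}
    (hb : JetEq 𝓘(ℝ, E) 𝓘(ℝ, EH) x (fun y => b y 0) (fun _ => 1))
    (hb' : JetEq 𝓘(ℝ, E) 𝓘(ℝ, EH) x (fun y => b' y 0) (fun _ => 1))
    (he : MDifferentiableAt 𝓘(ℝ, E) 𝓘(ℝ, ED) e x) (he' : MDifferentiableAt 𝓘(ℝ, E) 𝓘(ℝ, ED) e' x)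
    (hbd : ∀ k, MDifferentiableAt 𝓘(ℝ, E) 𝓘(ℝ, EH) (fun y => b y k) x)
    (hbd' : ∀ k, MDifferentiableAt 𝓘(ℝ, E) 𝓘(ℝ, EH) (fun y => b' y k) x) :
    JetEq 𝓘(ℝ, E) (modelN ED EH n) x (fun y => (cone (e y) (b y) : 𝔛.Nerve n))
        (fun y => cone (e' y) (b' y)) ↔
      JetEq 𝓘(ℝ, E) 𝓘(ℝ, ED) x e e' ∧
        ∀ k, JetEq 𝓘(ℝ, E) 𝓘(ℝ, EH) x (fun y => b y k) (fun y => b' y k) := by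
  refine ⟨fun h => ⟨?_, fun k => ?_⟩, fun h => jetEq_cone h.1 h.2⟩
  · have h₀ := h.comp (mdifferentiable_obj 0 _)
    simp only [obj_cone] at h₀
    refine (jetEq_congr ?_ ?_).1 h₀
    · simpa using (jetEq_bdry (𝔛 := 𝔛) hb).mul (.refl he)
    · simpa using (jetEq_bdry (𝔛 := 𝔛) hb').mul (.refl he')
  · have h₀ := h.comp (mdifferentiable_hom k 0 _)
    simp only [hom_cone] at h₀
    refine (jetEq_congr ?_ ?_).1 h₀
    · simpa using (JetEq.refl (hbd k)).mul hb.inv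
    · simpa using (JetEq.refl (hbd' k)).mul hb'.inv

namespace Cocycle

variable (c : Cocycle E 𝔛 O)

/-- The simplex `τ A τ⁻¹` for a cone `A` with the apex `e`. -/
theorem cone_gauge {n : ℕ} (d d' e : D) (b h h' : Fin (n + 1) → H) :
    (Nerve.cone d (fun k => (h k)⁻¹) * Nerve.cone e b *
        (Nerve.cone d' (fun k => (h' k)⁻¹))⁻¹ : 𝔛.Nerve n) =
      Nerve.cone (d * e * d'⁻¹)
        (fun k => (h k)⁻¹ * 𝔛.act d (b k) * 𝔛.act (d * e * d'⁻¹) (h' k)) := by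
  rw [Nerve.cone_inv, Nerve.cone_mul, Nerve.cone_mul]
  simp

/-- The face condition `∂₀A = τ A' τ⁻¹ + τ dτ⁻¹` between the element `A` of `Lie(N_{n+1} C)` with
the leading vertex `Y` and the edges `Z k`, and the element `A'` of `Lie(N_n C)` with the leading
vertex `Y'` and the edges `Z' k`, is equivalent to the equations of a gerbe connection. -/
theorem jetEq_twist_iff {n : ℕ} {a : Fin (n + 2) → ι} {x : X} (hx : x ∈ overlap O a)
    {Y Y' : E →L[ℝ] ED} {Z : Fin (n + 2) → E →L[ℝ] EH} {Z' : Fin (n + 1) → E →L[ℝ] EH}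
    (hZ' : Z' 0 = 0) {S : X → 𝔛.Nerve (n + 1)} {S' : X → 𝔛.Nerve n}
    (hS : HasDer 𝓘(ℝ, E) (modelN ED EH (n + 1)) S x (Nerve.dCone 𝔛 Y Z)) (hS1 : S x = 1)
    (hS' : HasDer 𝓘(ℝ, E) (modelN ED EH n) S' x (Nerve.dCone 𝔛 Y' Z')) (hS'1 : S' x = 1) :
    JetEq 𝓘(ℝ, E) (modelN ED EH n) x (fun y => (S y).face 0)
        (fun y => c.twist a x * S' y * (c.twist a y)⁻¹) ↔
      Y + 𝔛.dBdry.comp (Z 1) = (dAd 𝓘(ℝ, ED) (c.d (a 0) (a 1) x)).comp Y' +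
          dMulDInv 𝓘(ℝ, E) 𝓘(ℝ, ED) (c.d (a 0) (a 1)) x ∧
        ∀ k : Fin (n + 1), Z 1 + (𝔛.dActLie (c.d (a 0) (a 1) x)).comp (Z' k) =
          (dAd 𝓘(ℝ, EH) (c.h (a 0) (a 1) (a k.succ) x)).comp (Z k.succ) +
            dMulDInv 𝓘(ℝ, E) 𝓘(ℝ, EH) (c.h (a 0) (a 1) (a k.succ)) x +
            (𝔛.dT (c.h (a 0) (a 1) (a k.succ) x)).comp Y := by
  have hx' := mem_overlap.1 hx
  have : IsManifold 𝓘(ℝ, E) 1 X := isManifold_one _ _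
  have : IsManifold 𝓘(ℝ, ED) 1 D := isManifold_one _ _
  have : IsManifold 𝓘(ℝ, EH) 1 H := isManifold_one _ _
  -- Represent the linear data by maps with the value `1` at `x`.
  obtain ⟨A, hA1, hA⟩ := exists_hasDer_eq (I := 𝓘(ℝ, E)) (I₁ := 𝓘(ℝ, ED)) x (1 : D) Y
  obtain ⟨A', hA'1, hA'⟩ := exists_hasDer_eq (I := 𝓘(ℝ, E)) (I₁ := 𝓘(ℝ, ED)) x (1 : D) Y'
  choose b hb1 hb using fun k =>
    exists_hasDer_eq (I := 𝓘(ℝ, E)) (I₁ := 𝓘(ℝ, EH)) x (1 : H) (Z k)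
  choose b' hb'1 hb' using fun k =>
    exists_hasDer_eq (I := 𝓘(ℝ, E)) (I₁ := 𝓘(ℝ, EH)) x (1 : H) (Z' k)
  set d := c.d (a 0) (a 1)
  set h := fun k : Fin (n + 1) => c.h (a 0) (a 1) (a k.succ)
  have hd : MDifferentiableAt 𝓘(ℝ, E) 𝓘(ℝ, ED) d x := c.mdifferentiableAt_d (hx' _) (hx' _)
  have hh : ∀ k, MDifferentiableAt 𝓘(ℝ, E) 𝓘(ℝ, EH) (h k) x := fun k =>
    c.mdifferentiableAt_h (hx' _) (hx' _) (hx' _)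
  have hdc : MDifferentiableAt 𝓘(ℝ, E) 𝓘(ℝ, ED) (fun _ => d x) x := mdifferentiableAt_const
  let e := fun y => d x * A' y * (d y)⁻¹
  let r := fun y (k : Fin (n + 1)) =>
    (h k x)⁻¹ * 𝔛.act (d x) (b' k y) * 𝔛.act (e y) (h k y)
  have he : HasDer 𝓘(ℝ, E) 𝓘(ℝ, ED) e x ((dAd 𝓘(ℝ, ED) (d x)).comp Y' +
      dMulDInv 𝓘(ℝ, E) 𝓘(ℝ, ED) d x) := by
    refine ((hA'.conj (d x) hA'1).mul_one_one (hasDer_mulDInv hd) (by simp [hA'1])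
      (by simp)).of_eventuallyEq (.of_forall fun y => ?_)
    simp [e]
  have hr : ∀ k, MDifferentiableAt 𝓘(ℝ, E) 𝓘(ℝ, EH) (fun y => r y k) x := fun k =>
    (mdifferentiableAt_const.mul_group (𝔛.hasDer_act (d x) (hb' k) (hb'1 k)).mdifferentiableAt
      ).mul_group (mdifferentiableAt_act he.mdifferentiableAt (hh k))
  have hτ : ∀ y, Nerve.cone (𝔛 := 𝔛) (d x) (fun k => (h k x)⁻¹) *
      Nerve.cone (A' y) (fun k => b' k y) * (Nerve.cone (d y) (fun k => (h k y)⁻¹))⁻¹ =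
        Nerve.cone (e y) (r y) := fun y => cone_gauge _ _ _ _ _ _
  have eR : JetEq 𝓘(ℝ, E) (modelN ED EH n) x (fun y => c.twist a x * S' y * (c.twist a y)⁻¹)
      (fun y => Nerve.cone (e y) (r y)) := by
    simp_rw [← hτ]
    refine (JetEq.mul ?_ ?_).mul (c.jetEq_twist hx).inv
    · rw [c.twist_eq_cone hx]
      exact .refl mdifferentiableAt_const
    · exact .of_hasDer hS' (Nerve.hasDer_cone hA' hA'1 hb' hb'1)
        (by simp [hS'1, hA'1, hb'1, Nerve.cone_one]) rfl
  have eL : JetEq 𝓘(ℝ, E) (modelN ED EH n) x (fun y => (S y).face 0)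
      (fun y => Nerve.cone (𝔛.bdry (b 1 y) * A y) (fun k => b k.succ y * (b 1 y)⁻¹)) := by
    have h₀ : JetEq 𝓘(ℝ, E) (modelN ED EH (n + 1)) x S
        (fun y => Nerve.cone (A y) (fun k => b k y)) :=
      .of_hasDer hS (Nerve.hasDer_cone hA hA1 hb hb1)
        (by simp [hS1, hA1, hb1, Nerve.cone_one]) rfl
    have h₁ := h₀.comp (Nerve.mdifferentiable_map (Fin.succAbove 0) _)
    simp only [Nerve.map_cone] at h₁
    simp only [← Nerve.cone_eq_cone]
    exact h₁
  have hr₀ : JetEq 𝓘(ℝ, E) 𝓘(ℝ, EH) x (fun y => r y 0) (fun _ => 1) := by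
    have e₁ : JetEq 𝓘(ℝ, E) 𝓘(ℝ, EH) x (b' 0) (fun _ => 1) :=
      .of_hasDer (hb' 0) (HasDer.const _ _) (hb'1 0) hZ'
    have e₂ : JetEq 𝓘(ℝ, E) 𝓘(ℝ, EH) x (h 0) (fun _ => 1) := by
      refine .of_eventuallyEq mdifferentiableAt_const ?_
      filter_upwards [(overlap O a).isOpen.mem_nhds hx] with y hy
      exact c.h_self_right (mem_overlap.1 hy _) (mem_overlap.1 hy _)
    have hc : MDifferentiableAt 𝓘(ℝ, E) 𝓘(ℝ, EH) (fun _ => (h 0 x)⁻¹) x :=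
      mdifferentiableAt_const
    have := ((JetEq.refl hc).mul (jetEq_act (𝔛 := 𝔛) (.refl hdc) e₁)).mul
      (jetEq_act (𝔛 := 𝔛) (.refl he.mdifferentiableAt) e₂)
    simpa [r, e₂.1] using this
  have he' := ((𝔛.hasDer_bdry (hb 1) (hb1 1)).mul_one_one hA (by simp [hb1]) hA1)
  have hr' := fun k : Fin (n + 1) => (hb k.succ).mul_one_one ((hb 1).inv_one (hb1 1))
    (hb1 _) (by simp [hb1])
  rw [jetEq_congr eL eR, Nerve.jetEq_cone_iff (by simpa using JetEq.refl mdifferentiableAt_const)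
    hr₀ he'.mdifferentiableAt he.mdifferentiableAt (fun k => (hr' k).mdifferentiableAt) hr,
    jetEq_iff_of_hasDer he' he (by simp [e, hb1, hA1, hA'1])]
  rw [add_comm Y]
  refine and_congr_right fun hv => forall_congr' fun k => ?_
  have hk := hasDer_edge hA hA1 (hb 1) (hb1 1) (hb' k) (hb'1 k) (hh k)
    (.of_hasDer he he' (by simp [hb1, hA1, hA'1]) hv.symm)
  rw [jetEq_iff_of_hasDer (hr' k) hk (by simp [hb1, hb'1, hA'1]), sub_eq_add_neg,
    add_left_inj]
  -- The adjoint action of `h(x)` is invertible.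
  have h₁ : (dAd 𝓘(ℝ, EH) (h k x)).comp (dAd 𝓘(ℝ, EH) (h k x)⁻¹) = ContinuousLinearMap.id ℝ EH := by
    rw [← dAd_mul, mul_inv_cancel, dAd_one]
  have h₂ : (dAd 𝓘(ℝ, EH) (h k x)⁻¹).comp (dAd 𝓘(ℝ, EH) (h k x)) = ContinuousLinearMap.id ℝ EH := by
    rw [← dAd_mul, inv_mul_cancel, dAd_one]
  constructor
  · intro hz
    rw [hz, ← ContinuousLinearMap.comp_assoc, h₁, ContinuousLinearMap.id_comp]
    abel
  · intro hz
    have hz' : (𝔛.dActLie (d x)).comp (Z' k) + Z 1 - dMulDInv 𝓘(ℝ, E) 𝓘(ℝ, EH) (h k) x -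
        (𝔛.dT (h k x)).comp Y = (dAd 𝓘(ℝ, EH) (h k x)).comp (Z k.succ) := by
      rw [sub_sub, sub_eq_iff_eq_add]
      exact (add_comm _ _).trans (hz.trans (add_assoc _ _ _))
    rw [hz', ← ContinuousLinearMap.comp_assoc, h₂, ContinuousLinearMap.id_comp]

end Cocycle

end Gerbe

/-! ### From gerbe connections to simplicial connections -/

section Gerbe

open CrossedModule

theorem dMulDInv_val {E E₁ B B₁ M G : Type*} [NormedAddCommGroup E] [NormedSpace ℝ E]
    [NormedAddCommGroup E₁] [NormedSpace ℝ E₁] [TopologicalSpace B] [TopologicalSpace B₁]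
    {I : ModelWithCorners ℝ E B} {I₁ : ModelWithCorners ℝ E₁ B₁}
    [TopologicalSpace M] [ChartedSpace B M] [TopologicalSpace G] [ChartedSpace B₁ G] [Group G]
    [LieGroup I₁ ∞ G] {U : Opens M} (x : U) {f : M → G} (hf : MDifferentiableAt I I₁ f x) :
    dMulDInv I I₁ (fun y : U => f y) x = dMulDInv I I₁ f (x : M) :=
  (hasDer_mulDInv (hasDer_der hf).val.mdifferentiableAt).eq (hasDer_mulDInv hf).val

theorem hasDer_incl {E B M : Type*} [NormedAddCommGroup E] [NormedSpace ℝ E] [TopologicalSpace B]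
    {I : ModelWithCorners ℝ E B} [TopologicalSpace M] [ChartedSpace B M] {U V : Opens M}
    (h : U ≤ V) (x : U) : HasDer I I (incl h) x (ContinuousLinearMap.id ℝ E) :=
  HasDer.codRestrict (hasDer_val x)

variable {ED EH D H : Type*}
  [NormedAddCommGroup ED] [NormedSpace ℝ ED] [NormedAddCommGroup EH] [NormedSpace ℝ EH]
  [TopologicalSpace D] [ChartedSpace ED D] [Group D] [LieGroup 𝓘(ℝ, ED) ∞ D]
  [TopologicalSpace H] [ChartedSpace EH H] [Group H] [LieGroup 𝓘(ℝ, EH) ∞ H]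
  {E X : Type*} [NormedAddCommGroup E] [NormedSpace ℝ E]
  [TopologicalSpace X] [ChartedSpace E X] [IsManifold 𝓘(ℝ, E) ∞ X]
  {ι : Type*} {𝔛 : CrossedModule ED EH D H} {O : ι → Opens X} {c : Cocycle E 𝔛 O}

namespace GerbeConnection

variable (G : GerbeConnection c)

/-- The value of `A_α` at a point. -/
def Aat (α : ι) (x : X) (hx : x ∈ O α) : E →L[ℝ] ED := (G.A α).at ⟨x, hx⟩

/-- The value of `a_{αβ}` at a point. -/
def aat (α β : ι) (x : X) (hα : x ∈ O α) (hβ : x ∈ O β) : E →L[ℝ] EH :=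
  (G.a α β).at ⟨x, hα, hβ⟩

theorem transform_Aat (α β : ι) (x : X) (hα : x ∈ O α) (hβ : x ∈ O β) :
    G.Aat α x hα + 𝔛.dBdry.comp (G.aat α β x hα hβ) =
      (dAd 𝓘(ℝ, ED) (c.d α β x)).comp (G.Aat β x hβ) +
        dMulDInv 𝓘(ℝ, E) 𝓘(ℝ, ED) (c.d α β) x := by
  let x' : (O α ⊓ O β : Opens X) := ⟨x, hα, hβ⟩
  have h : (G.A α).pullAt 𝓘(ℝ, E) (incl inf_le_left) x' + 𝔛.dBdry.comp ((G.a α β).at x') =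
      (dAd 𝓘(ℝ, ED) (c.d α β x)).comp ((G.A β).pullAt 𝓘(ℝ, E) (incl inf_le_right) x') +
        dMulDInv 𝓘(ℝ, E) 𝓘(ℝ, ED) (fun y : (O α ⊓ O β : Opens X) => c.d α β y) x' :=
    G.transform_A α β x'
  rw [OneForm.pullAt_eq _ (hasDer_incl _ _), OneForm.pullAt_eq _ (hasDer_incl _ _),
    dMulDInv_val x' (c.mdifferentiableAt_d hα hβ), ContinuousLinearMap.comp_id,
    ContinuousLinearMap.comp_id] at h
  exact h

theorem transform_aat (α β γ : ι) (x : X) (hα : x ∈ O α) (hβ : x ∈ O β) (hγ : x ∈ O γ) :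
    G.aat α β x hα hβ + (𝔛.dActLie (c.d α β x)).comp (G.aat β γ x hβ hγ) =
      (dAd 𝓘(ℝ, EH) (c.h α β γ x)).comp (G.aat α γ x hα hγ) +
        dMulDInv 𝓘(ℝ, E) 𝓘(ℝ, EH) (c.h α β γ) x + (𝔛.dT (c.h α β γ x)).comp (G.Aat α x hα) := by
  let x' : (O α ⊓ O β ⊓ O γ : Opens X) := ⟨x, ⟨hα, hβ⟩, hγ⟩
  have h : (G.a α β).pullAt 𝓘(ℝ, E) (incl inf_le_left) x' + (𝔛.dActLie (c.d α β x)).comp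
        ((G.a β γ).pullAt 𝓘(ℝ, E) (incl (inf_le_inf_right _ inf_le_right)) x') =
      (dAd 𝓘(ℝ, EH) (c.h α β γ x)).comp
          ((G.a α γ).pullAt 𝓘(ℝ, E) (incl (inf_le_inf_right _ inf_le_left)) x') +
        dMulDInv 𝓘(ℝ, E) 𝓘(ℝ, EH) (fun y : (O α ⊓ O β ⊓ O γ : Opens X) => c.h α β γ y) x' +
        (𝔛.dT (c.h α β γ x)).comp
          ((G.A α).pullAt 𝓘(ℝ, E) (incl (inf_le_left.trans inf_le_left)) x') :=
    G.transform_a α β γ x'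
  simp only [OneForm.pullAt_eq _ (hasDer_incl (I := 𝓘(ℝ, E)) _ _),
    dMulDInv_val x' (c.mdifferentiableAt_h hα hβ hγ), ContinuousLinearMap.comp_id] at h
  exact h

/-- Since `h_{ααα} = 1`, the second equation of a gerbe connection for the indices `(α, α, α)` reads
`2 a_{αα} = a_{αα}`. -/
theorem aat_self (α : ι) (x : X) (hα : x ∈ O α) : G.aat α α x hα hα = 0 := by
  have h := G.transform_aat α α α x hα hα hα
  have h₁ : c.h α α α x = 1 := c.normalized α x hα
  have h₂ : dMulDInv 𝓘(ℝ, E) 𝓘(ℝ, EH) (c.h α α α) x = 0 := by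
    refine (hasDer_mulDInv (c.mdifferentiableAt_h hα hα hα)).eq
      ((HasDer.const (1 : H) x).of_eventuallyEq ?_)
    filter_upwards [(O α).isOpen.mem_nhds hα] with y hy
    rw [h₁, c.normalized α y hy, inv_one, one_mul]
  have h₃ : 𝔛.dT (1 : H) = 0 := by
    have h := 𝔛.hasDer_T (1 : H) (HasDer.id (I := 𝓘(ℝ, ED)) (1 : D)) rfl
    simp only [inv_one, map_one, mul_one, ContinuousLinearMap.comp_id] at h
    exact h.eq (HasDer.const _ _)
  have h₄ : 𝔛.dActLie (1 : D) = ContinuousLinearMap.id ℝ EH := by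
    have h := 𝔛.hasDer_act (1 : D) (HasDer.id (I := 𝓘(ℝ, EH)) (1 : H)) rfl
    simp only [map_one, MulAut.one_apply, ContinuousLinearMap.comp_id] at h
    exact h.eq (HasDer.id _)
  rw [h₂, h₁, c.d_self hα, h₃, h₄, dAd_one] at h
  simpa using h

/-- The local form on the component `a` of the simplicial connection of a gerbe connection. It has
the vertices `A_{α₀} + α(a_{α₀αₖ})` and the edges `a_{α₀αᵢ} - a_{α₀αⱼ}`. -/
def loc {n : ℕ} (a : Fin (n + 1) → ι) (x : overlap O a) : E →L[ℝ] ED × (Fin n → EH) :=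
  Nerve.dCone 𝔛 (G.Aat (a 0) x (Cocycle.mem_overlap.1 x.2 0)) (fun k =>
    G.aat (a 0) (a k) x (Cocycle.mem_overlap.1 x.2 0) (Cocycle.mem_overlap.1 x.2 k))

theorem contMDiff_loc {n : ℕ} (a : Fin (n + 1) → ι) :
    ContMDiff (M := TangentBundle 𝓘(ℝ, E) (overlap O a)) 𝓘(ℝ, E).tangent
      𝓘(ℝ, ED × (Fin n → EH)) ∞ (fun v => G.loc a v.1 v.2) := by
  have hA : ContMDiff (M := TangentBundle 𝓘(ℝ, E) (overlap O a)) 𝓘(ℝ, E).tangent 𝓘(ℝ, ED) ∞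
      (fun v => G.Aat (a 0) v.1 (Cocycle.mem_overlap.1 v.1.2 0) v.2) := by
    have hle : overlap O a ≤ O (a 0) := fun x hx => Cocycle.mem_overlap.1 hx 0
    have h := (G.A (a 0)).contMDiff_pull (I₂ := 𝓘(ℝ, E)) (f := incl hle)
      (contMDiff_inclusion hle)
    simp only [OneForm.pullAt_eq _ (hasDer_incl (I := 𝓘(ℝ, E)) _ _),
      ContinuousLinearMap.comp_id] at h
    exact h
  have ha : ∀ k, ContMDiff (M := TangentBundle 𝓘(ℝ, E) (overlap O a)) 𝓘(ℝ, E).tangent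
      𝓘(ℝ, EH) ∞ (fun v => G.aat (a 0) (a k) v.1 (Cocycle.mem_overlap.1 v.1.2 0)
        (Cocycle.mem_overlap.1 v.1.2 k) v.2) := by
    intro k
    have hle : overlap O a ≤ O (a 0) ⊓ O (a k) := fun x hx =>
      ⟨Cocycle.mem_overlap.1 hx 0, Cocycle.mem_overlap.1 hx k⟩
    have h := (G.a (a 0) (a k)).contMDiff_pull (I₂ := 𝓘(ℝ, E)) (f := incl hle)
      (contMDiff_inclusion hle)
    simp only [OneForm.pullAt_eq _ (hasDer_incl (I := 𝓘(ℝ, E)) _ _),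
      ContinuousLinearMap.comp_id] at h
    exact h
  exact ((𝔛.dBdry.contMDiff.comp (ha _)).add hA).prodMk_space
    (contMDiff_pi_space.2 fun k => (ha _).add (ha _).neg)

/-- The local forms are compatible with reindexing by maps that preserve the leading vertex. -/
theorem mapLie_loc {n m : ℕ} (a : Fin (n + 1) → ι) (x : overlap O a)
    (θ : Fin (m + 1) → Fin (n + 1)) (h0 : θ 0 = 0) :
    (𝔛.mapLie θ).comp (G.loc a x) = G.loc (a ∘ θ) (overlapMap O a θ x) := by
  rw [loc, mapLie_comp_dCone]
  simp only [loc, Function.comp, h0]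
  rfl

theorem exists_hasDer_loc {n : ℕ} (a : Fin (n + 1) → ι) (x : overlap O a) :
    ∃ S : X → 𝔛.Nerve n, S x = 1 ∧ HasDer 𝓘(ℝ, E) (modelN ED EH n) S (x : X) (G.loc a x) := by
  have : IsManifold (modelN ED EH n) 1 (𝔛.Nerve n) := isManifold_one _ _
  have : IsManifold 𝓘(ℝ, E) 1 X := isManifold_one _ _
  exact exists_hasDer_eq _ _ _

theorem jetEq_face {n : ℕ} (a : Fin (n + 2) → ι) (i : Fin (n + 2)) (x : overlap O a)
    {S : X → 𝔛.Nerve (n + 1)} {S' : X → 𝔛.Nerve n}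
    (hS : HasDer 𝓘(ℝ, E) (modelN ED EH (n + 1)) S (x : X) (G.loc a x)) (hS1 : S x = 1)
    (hS' : HasDer 𝓘(ℝ, E) (modelN ED EH n) S' (x : X)
      (G.loc (a ∘ i.succAbove) (overlapMap O a i.succAbove x))) (hS'1 : S' x = 1) :
    JetEq 𝓘(ℝ, E) (modelN ED EH n) (x : X) (fun y => (S y).face i)
      (fun y => c.faceFactor a i x * S' y * (c.faceFactor a i y)⁻¹) := by
  have hx := Cocycle.mem_overlap.1 x.2
  by_cases hi : i = 0
  · subst hi
    simp only [Cocycle.faceFactor, if_true]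
    have e : G.loc (a ∘ Fin.succAbove 0) (overlapMap O a (Fin.succAbove 0) x) =
        Nerve.dCone 𝔛 (G.Aat (a 1) x (hx 1)) fun k =>
          G.aat (a 1) (a k.succ) x (hx 1) (hx k.succ) := by
      simp only [loc, Function.comp, Fin.zero_succAbove, Fin.succ_zero_eq_one]
      rfl
    rw [e] at hS'
    refine (c.jetEq_twist_iff x.2 (by simpa using G.aat_self _ _ _) hS hS1 hS' hS'1).2
      ⟨G.transform_Aat _ _ _ _ _, fun k => G.transform_aat _ _ _ _ _ _ _⟩
  · simp only [Cocycle.faceFactor, hi, if_false, one_mul, inv_one, mul_one]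
    refine .of_hasDer (hS.lieMap (Nerve.mdifferentiable_map i.succAbove 1) hS1) hS' ?_
      (G.mapLie_loc a x _ (Fin.succAbove_ne_zero_zero hi))
    rw [hS1, hS'1]
    exact Nerve.map_one _

/-- The simplicial connection of a gerbe connection. -/
def toSimplicial : SimplicialConnection c where
  form {n} a :=
    { toFun := fun p => totalForm (modelN ED EH n) p.1 (G.loc a p.2)
      smooth := contMDiff_totalForm (G.contMDiff_loc a) }
  face {n} a i p := by
    obtain ⟨g, x⟩ := p
    obtain ⟨S, hS1, hS⟩ := G.exists_hasDer_loc a x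
    obtain ⟨S', hS'1, hS'⟩ := G.exists_hasDer_loc (a ∘ i.succAbove) (overlapMap O a i.succAbove x)
    rw [c.totalFace_eq]
    exact totalForm_comp_of_jetEq (φ := Nerve.face i) (ι := overlapMap O a i.succAbove)
      (w := fun y : overlap O a => c.faceFactor a i y) (S₂ := fun y => S' y)
      (Nerve.mdifferentiable_map i.succAbove) (Nerve.map_mul _)
      (hasDer_der (c.mdifferentiableAt_faceFactor a i x.2)).val.mdifferentiableAt
      (hasDer_overlapMap a _ x).mdifferentiableAt hS.val hS1
      (HasDer.val (x := overlapMap O a i.succAbove x) hS') hS'1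
      ((G.jetEq_face a i x hS hS1 hS' hS'1).precomp (hasDer_val x).mdifferentiableAt rfl) g
  degen {n} a i p := by
    obtain ⟨g, x⟩ := p
    obtain ⟨S, hS1, hS⟩ := G.exists_hasDer_loc a x
    obtain ⟨S', hS'1, hS'⟩ := G.exists_hasDer_loc (a ∘ i.predAbove) (overlapMap O a i.predAbove x)
    have h : JetEq 𝓘(ℝ, E) (modelN ED EH (n + 1)) (x : X) (fun y => (S y).degen i)
        (fun y => 1 * S' y * 1⁻¹) := by
      simp only [one_mul, inv_one, mul_one]
      refine .of_hasDer (hS.lieMap (Nerve.mdifferentiable_map i.predAbove 1) hS1) hS' ?_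
        (G.mapLie_loc a x _ Fin.predAbove_right_zero)
      rw [hS1]
      exact (Nerve.map_one _).trans hS'1.symm
    rw [c.totalDegen_eq]
    exact totalForm_comp_of_jetEq (φ := Nerve.degen i) (ι := overlapMap O a i.predAbove)
      (w := fun y : overlap O a => (1 : 𝔛.Nerve (n + 1))) (S₂ := fun y => S' y)
      (Nerve.mdifferentiable_map i.predAbove) (Nerve.map_mul _) mdifferentiableAt_const
      (hasDer_overlapMap a _ x).mdifferentiableAt hS.val hS1
      (HasDer.val (x := overlapMap O a i.predAbove x) hS') hS'1
      (h.precomp (hasDer_val x).mdifferentiableAt rfl) g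
  equivariant {n} a g p := totalForm_mul g p.1 (G.loc a p.2) p.2
  cartanMaurer {n} a x g := by
    have h := (HasDer.id (I := modelN ED EH n) g).prodMk (HasDer.const (I₁ := 𝓘(ℝ, E)) x g)
    refine (congrArg (fun L => (totalForm (modelN ED EH n) g (G.loc a x)).comp L) h.der_eq).trans ?_
    exact totalForm_comp_inl g (G.loc a x)

theorem loc_toSimplicial {n : ℕ} (a : Fin (n + 1) → ι) (x : overlap O a) :
    G.toSimplicial.loc a x = G.loc a x := by
  refine (totalForm_comp_inr (1 : 𝔛.Nerve n) (G.loc a x)).trans ?_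
  rw [dAd_one, ContinuousLinearMap.id_comp]

end GerbeConnection

/-! ### The correspondence -/

theorem hasDer_section₀ (α : ι) (x : O α) :
    HasDer 𝓘(ℝ, E) ((modelN ED EH 0).prod 𝓘(ℝ, E)) (section₀ c α) x
      (ContinuousLinearMap.inr ℝ (ED × (Fin 0 → EH)) E) :=
  (HasDer.const (I₁ := modelN ED EH 0) (1 : 𝔛.Nerve 0) x).prodMk (HasDer.codRestrict (hasDer_val x))

theorem hasDer_section₁ (α β : ι) (x : (O α ⊓ O β : Opens X)) :
    HasDer 𝓘(ℝ, E) ((modelN ED EH 1).prod 𝓘(ℝ, E)) (section₁ c α β) x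
      (ContinuousLinearMap.inr ℝ (ED × (Fin 1 → EH)) E) :=
  (HasDer.const (I₁ := modelN ED EH 1) (1 : 𝔛.Nerve 1) x).prodMk (HasDer.codRestrict (hasDer_val x))

theorem contMDiff_section₀ (α : ι) :
    ContMDiff 𝓘(ℝ, E) ((modelN ED EH 0).prod 𝓘(ℝ, E)) ∞ (section₀ c α) :=
  contMDiff_const.prodMk ((ContMDiff.subtypeVal_comp_iff _ _).1 contMDiff_subtype_val)

theorem contMDiff_section₁ (α β : ι) :
    ContMDiff 𝓘(ℝ, E) ((modelN ED EH 1).prod 𝓘(ℝ, E)) ∞ (section₁ c α β) :=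
  contMDiff_const.prodMk ((ContMDiff.subtypeVal_comp_iff _ _).1 contMDiff_subtype_val)

/-- The correspondence in terms of local forms. The edge from the vertex `0` to the vertex `1` is
inverse to the edge in the definition of the correspondence, so that no sign remains. -/
theorem corresponds_iff (𝒜 : SimplicialConnection c) (G : GerbeConnection c) :
    Corresponds 𝒜 G ↔
      (∀ α (x : O α), (G.A α).at x = (𝔛.objLie 0).comp (𝒜.loc ![α] (section₀ c α x).2)) ∧
      ∀ α β (x : (O α ⊓ O β : Opens X)), (G.a α β).at x =
        (𝔛.homLie 1 0).comp (𝒜.loc ![α, β] (section₁ c α β x).2) := by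
  refine and_congr (forall_congr' fun α => forall_congr' fun x => ?_)
    (forall_congr' fun α => forall_congr' fun β => forall_congr' fun x => ?_)
  · have h := (𝒜.form (n := 0) ![α]).pullAt_eq (hasDer_section₀ (c := c) α x)
    change _ = (𝔛.objLie 0).comp ((𝒜.form (n := 0) ![α]).pullAt 𝓘(ℝ, E) (section₀ c α) x) ↔ _
    rw [h]
    rfl
  · have h := (𝒜.form (n := 1) ![α, β]).pullAt_eq (hasDer_section₁ (c := c) α β x)
    change _ = -(𝔛.homLie 0 1).comp
      ((𝒜.form (n := 1) ![α, β]).pullAt 𝓘(ℝ, E) (section₁ c α β) x) ↔ _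
    rw [h, homLie_symm 1 0, ContinuousLinearMap.neg_comp]
    rfl

namespace SimplicialConnection

variable (𝒜 : SimplicialConnection c)

/-- The vertex part of the local form over `O_α`. -/
def formA (α : ι) : OneForm 𝓘(ℝ, E) (O α) 𝓘(ℝ, ED) D where
  toFun x := (𝔛.objLie 0).comp (𝒜.loc ![α] (section₀ c α x).2)
  smooth := by
    have h := (𝔛.objLie (n := 0) 0).contMDiff.comp
      ((𝒜.form (n := 0) ![α]).contMDiff_pull (I₂ := 𝓘(ℝ, E)) (contMDiff_section₀ α))
    simp only [OneForm.pullAt_eq _ (hasDer_section₀ (c := c) α _)] at h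
    exact h

/-- The edge part of the local form over `O_α ∩ O_β`. -/
def forma (α β : ι) : OneForm 𝓘(ℝ, E) (O α ⊓ O β : Opens X) 𝓘(ℝ, EH) H where
  toFun x := (𝔛.homLie 1 0).comp (𝒜.loc ![α, β] (section₁ c α β x).2)
  smooth := by
    have h := (𝔛.homLie (n := 1) 1 0).contMDiff.comp
      ((𝒜.form (n := 1) ![α, β]).contMDiff_pull (I₂ := 𝓘(ℝ, E)) (contMDiff_section₁ α β))
    simp only [OneForm.pullAt_eq _ (hasDer_section₁ (c := c) α β _)] at h
    exact h

theorem loc_eq_form {n : ℕ} (a : Fin (n + 1) → ι) (x : overlap O a) :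
    𝒜.loc a x = Nerve.dCone 𝔛 ((𝒜.formA (a 0)).at ⟨x, Cocycle.mem_overlap.1 x.2 0⟩) (fun k =>
      (𝒜.forma (a 0) (a k)).at
        ⟨x, Cocycle.mem_overlap.1 x.2 0, Cocycle.mem_overlap.1 x.2 k⟩) := by
  refine 𝒜.loc_eq a x (fun x' hx => ?_) (fun k x' hx => ?_)
  · obtain ⟨x', _⟩ := x'
    subst hx
    rfl
  · obtain ⟨x', _⟩ := x'
    subst hx
    rfl

theorem forma_self (α : ι) (x : (O α ⊓ O α : Opens X)) : (𝒜.forma α α).at x = 0 :=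
  𝒜.homLie_loc_self α _

/-- The face condition for `∂₀` yields the equations of a gerbe connection. -/
theorem transform {n : ℕ} (a : Fin (n + 2) → ι) (x : X) (hx : ∀ i, x ∈ O (a i)) :
    (𝒜.formA (a 0)).at ⟨x, hx 0⟩ + 𝔛.dBdry.comp ((𝒜.forma (a 0) (a 1)).at ⟨x, hx 0, hx 1⟩) =
        (dAd 𝓘(ℝ, ED) (c.d (a 0) (a 1) x)).comp ((𝒜.formA (a 1)).at ⟨x, hx 1⟩) +
          dMulDInv 𝓘(ℝ, E) 𝓘(ℝ, ED) (c.d (a 0) (a 1)) x ∧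
      ∀ k : Fin (n + 1), (𝒜.forma (a 0) (a 1)).at ⟨x, hx 0, hx 1⟩ +
          (𝔛.dActLie (c.d (a 0) (a 1) x)).comp
            ((𝒜.forma (a 1) (a k.succ)).at ⟨x, hx 1, hx k.succ⟩) =
        (dAd 𝓘(ℝ, EH) (c.h (a 0) (a 1) (a k.succ) x)).comp
            ((𝒜.forma (a 0) (a k.succ)).at ⟨x, hx 0, hx k.succ⟩) +
          dMulDInv 𝓘(ℝ, E) 𝓘(ℝ, EH) (c.h (a 0) (a 1) (a k.succ)) x +
          (𝔛.dT (c.h (a 0) (a 1) (a k.succ) x)).comp ((𝒜.formA (a 0)).at ⟨x, hx 0⟩) := by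
  let x' : overlap O a := ⟨x, Cocycle.mem_overlap.2 hx⟩
  obtain ⟨S, hS1, hS⟩ := 𝒜.exists_hasDer_loc a x'
  obtain ⟨S', hS'1, hS'⟩ :=
    𝒜.exists_hasDer_loc (a ∘ Fin.succAbove 0) (overlapMap O a (Fin.succAbove 0) x')
  have h := 𝒜.jetEq_face a 0 x' hS hS1 hS' hS'1
  simp only [Cocycle.faceFactor, if_true] at h
  have e : 𝒜.loc (a ∘ Fin.succAbove 0) (overlapMap O a (Fin.succAbove 0) x') =
      Nerve.dCone 𝔛 ((𝒜.formA (a 1)).at ⟨x, hx 1⟩) fun k =>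
        (𝒜.forma (a 1) (a k.succ)).at ⟨x, hx 1, hx k.succ⟩ := by
    rw [loc_eq_form]
    simp only [Function.comp, Fin.zero_succAbove, Fin.succ_zero_eq_one]
    rfl
  rw [loc_eq_form] at hS
  rw [e] at hS'
  exact (c.jetEq_twist_iff x'.2 (𝒜.forma_self _ _) hS hS1 hS' hS'1).1 h

/-- The gerbe connection of a simplicial connection. -/
def toGerbe : GerbeConnection c where
  A := 𝒜.formA
  a := 𝒜.forma
  transform_A α β x := by
    have h := (𝒜.transform ![α, β] x (Fin.forall_fin_two.2 ⟨x.2.1, x.2.2⟩)).1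
    change (𝒜.formA α).pullAt 𝓘(ℝ, E) (incl inf_le_left) x + 𝔛.dBdry.comp ((𝒜.forma α β).at x) =
      (dAd 𝓘(ℝ, ED) (c.d α β x)).comp ((𝒜.formA β).pullAt 𝓘(ℝ, E) (incl inf_le_right) x) +
        dMulDInv 𝓘(ℝ, E) 𝓘(ℝ, ED) (fun y : (O α ⊓ O β : Opens X) => c.d α β y) x
    rw [OneForm.pullAt_eq _ (hasDer_incl _ _), OneForm.pullAt_eq _ (hasDer_incl _ _),
      dMulDInv_val x (c.mdifferentiableAt_d x.2.1 x.2.2), ContinuousLinearMap.comp_id,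
      ContinuousLinearMap.comp_id]
    exact h
  transform_a α β γ x := by
    have h := (𝒜.transform ![α, β, γ] x
      (by intro i; fin_cases i; exacts [x.2.1.1, x.2.1.2, x.2.2])).2 1
    change (𝒜.forma α β).pullAt 𝓘(ℝ, E) (incl inf_le_left) x + (𝔛.dActLie (c.d α β x)).comp
          ((𝒜.forma β γ).pullAt 𝓘(ℝ, E) (incl (inf_le_inf_right _ inf_le_right)) x) =
        (dAd 𝓘(ℝ, EH) (c.h α β γ x)).comp
            ((𝒜.forma α γ).pullAt 𝓘(ℝ, E) (incl (inf_le_inf_right _ inf_le_left)) x) +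
          dMulDInv 𝓘(ℝ, E) 𝓘(ℝ, EH) (fun y : (O α ⊓ O β ⊓ O γ : Opens X) => c.h α β γ y) x +
          (𝔛.dT (c.h α β γ x)).comp
            ((𝒜.formA α).pullAt 𝓘(ℝ, E) (incl (inf_le_left.trans inf_le_left)) x)
    simp only [OneForm.pullAt_eq _ (hasDer_incl (I := 𝓘(ℝ, E)) _ _),
      dMulDInv_val x (c.mdifferentiableAt_h x.2.1.1 x.2.1.2 x.2.2), ContinuousLinearMap.comp_id]
    exact h

/-- A simplicial connection is determined by its local forms. -/
theorem ext_loc {𝒜 𝒜' : SimplicialConnection c}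
    (h : ∀ {n : ℕ} (a : Fin (n + 1) → ι) (x : overlap O a), 𝒜.loc a x = 𝒜'.loc a x) :
    𝒜 = 𝒜' := by
  refine SimplicialConnection.ext ?_
  funext n a
  exact OneForm.ext_at fun p => by rw [𝒜.form_at a p.1 p.2, 𝒜'.form_at a p.1 p.2, h]

end SimplicialConnection

theorem corresponds_toSimplicial (G : GerbeConnection c) : Corresponds G.toSimplicial G := by
  refine (corresponds_iff _ _).2 ⟨fun α x => ?_, fun α β x => ?_⟩
  · rw [G.loc_toSimplicial, GerbeConnection.loc, objLie_comp_dCone, G.aat_self,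
      ContinuousLinearMap.comp_zero, zero_add]
    rfl
  · rw [G.loc_toSimplicial, GerbeConnection.loc, homLie_comp_dCone, G.aat_self, neg_zero, add_zero]
    rfl

theorem corresponds_toGerbe (𝒜 : SimplicialConnection c) : Corresponds 𝒜 𝒜.toGerbe :=
  (corresponds_iff _ _).2 ⟨fun _ _ => rfl, fun _ _ _ => rfl⟩

theorem Corresponds.eq_toGerbe {𝒜 : SimplicialConnection c} {G : GerbeConnection c}
    (h : Corresponds 𝒜 G) : G = 𝒜.toGerbe := by
  obtain ⟨hA, ha⟩ := (corresponds_iff _ _).1 h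
  exact GerbeConnection.ext (funext fun α => OneForm.ext_at (hA α))
    (funext fun α => funext fun β => OneForm.ext_at (ha α β))

theorem Corresponds.eq {𝒜 𝒜' : SimplicialConnection c} {G : GerbeConnection c}
    (h : Corresponds 𝒜 G) (h' : Corresponds 𝒜' G) : 𝒜 = 𝒜' := by
  have e : 𝒜.toGerbe = 𝒜'.toGerbe := h.eq_toGerbe.symm.trans h'.eq_toGerbe
  have eA : 𝒜.formA = 𝒜'.formA := congrArg GerbeConnection.A e
  have ea : 𝒜.forma = 𝒜'.forma := congrArg GerbeConnection.a e
  refine SimplicialConnection.ext_loc fun a x => ?_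
  rw [𝒜.loc_eq_form, 𝒜'.loc_eq_form, eA, ea]

end Gerbe

end CrossedGerbe

end

theorem proposition6p2 {ED EH D H E X ι : Type*}
    [NormedAddCommGroup ED] [NormedSpace ℝ ED] [NormedAddCommGroup EH] [NormedSpace ℝ EH]
    [TopologicalSpace D] [ChartedSpace ED D] [Group D] [LieGroup 𝓘(ℝ, ED) ∞ D]
    [TopologicalSpace H] [ChartedSpace EH H] [Group H] [LieGroup 𝓘(ℝ, EH) ∞ H]
    [NormedAddCommGroup E] [NormedSpace ℝ E]
    [TopologicalSpace X] [ChartedSpace E X] [IsManifold 𝓘(ℝ, E) ∞ X]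
    (𝔛 : CrossedGerbe.CrossedModule ED EH D H)
    (O : ι → Opens X) (hO : IsOpenCover O) (c : CrossedGerbe.Cocycle E 𝔛 O) :
    (∀ G : CrossedGerbe.GerbeConnection c,
      ∃! 𝒜 : CrossedGerbe.SimplicialConnection c, CrossedGerbe.Corresponds 𝒜 G) ∧
    (∀ 𝒜 : CrossedGerbe.SimplicialConnection c,
      ∃! G : CrossedGerbe.GerbeConnection c, CrossedGerbe.Corresponds 𝒜 G) :=
  ⟨fun G => ⟨G.toSimplicial, CrossedGerbe.corresponds_toSimplicial G,
      fun _ h => h.eq (CrossedGerbe.corresponds_toSimplicial G)⟩,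
    fun 𝒜 => ⟨𝒜.toGerbe, CrossedGerbe.corresponds_toGerbe 𝒜, fun _ h => h.eq_toGerbe⟩⟩
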